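/- Let $\Gamma$ be a connected compact metric graph: finitely many vertices $\mathrm V(\Gamma)$ and edges $\mathrm E(\Gamma)$ (at least one edge; loops and multiple edges allowed), where each edge $e$ is a copy of an interval $[0,\ell_e]$ with $0<\ell_e<\infty$, glued to its end vertices. A function $u$ on $\Gamma$ has a restriction $u_e$ to each edge $e$; write $\int_\Gamma f\,dx=\sum_e\int_0^{\ell_e} f_e\,dx$, and let $\|\cdot\|_{L^p(\Gamma)}$, $1\le p\le\infty$, be the corresponding norms. Let $d$ be the shortest-path distance on $\Gamma$. For $1\le p\le\infty$ let $W^{1,p}(\Gamma)$ be the space of continuous functions $u$ on $\Gamma$ with $u_e\in W^{1,p}(0,\ell_e)$ for every edge $e$, with norm $\|u\|_{W^{1,p}(\Gamma)}=\big(\int_\Gamma|u|^p\,dx+\int_\Gamma|u'|^p\,dx\big)^{1/p}$ for $p<\infty$. Let $\mathrm V_D$ be a non-empty set of vertices. For $1<p<\infty$ put $$\lambda_{1,p}(\Gamma,\mathrm V_D)=\inf\left\{\frac{\int_\Gamma|u'|^p\,dx}{\int_\Gamma|u|^p\,dx}\colon u\in W^{1,p}(\Gamma),\ u=0\text{ on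 }\mathrm V_D,\ u\ne0\right\},$$ and put $$\Lambda_\infty(\Gamma,\mathrm V_D)=\inf\left\{\frac{\|v'\|_{L^\infty(\Gamma)}}{\|v\|_{L^\infty(\Gamma)}}\colon v\in W^{1,\infty}(\Gamma),\ v=0\text{ on }\mathrm V_D,\ v\ne0\right\}.$$ (1) For every $p\in(1,\infty)$ let $u_p$ be a minimizer for $\lambda_{1,p}(\Gamma,\mathrm V_D)$ with $\|u_p\|_{L^p(\Gamma)}=1$. Then there are a sequence $p_j\to\infty$ and a function $u_\infty$ on $\Gamma$ such that $u_{p_j}\to u_\infty$ uniformly in $\Gamma$ and weakly in $W^{1,q}(\Gamma)$ for every $1\le q<\infty$. Moreover, whenever $p_j\to\infty$ is a sequence in $(1,\infty)$ for which $u_{p_j}$ converges uniformly in $\Gamma$ to some $u_\infty$, the limit $u_\infty$ is a minimizer for $\Lambda_\infty(\Gamma,\mathrm V_D)$. (2) $\lambda_{1,p}(\Gamma,\mathrm V_D)^{1/p}\to\Lambda_\infty(\Gamma,\mathrm V_D)$ as $p\to\infty$. (3) The maximum $\max_{x\in\Gamma}d(x,\mathrm V_D)$ exists and is positive, where $d(x,\mathrm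 V_D)=\min_{\mathrm v\in\mathrm V_D}d(x,\mathrm v)$, and $$\Lambda_\infty(\Gamma,\mathrm V_D)=\frac{1}{\max_{x\in\Gamma}d(x,\mathrm V_D)}.$$ -/

import Mathlib

open Set Filter Topology MeasureTheory
open scoped ENNReal ContDiff

noncomputable section

/-- A metric graph whose edges all have finite length, with vertex set `V` and edge set `E`
(loops and multiple edges allowed).  Each edge carries one chosen orientation, an initial and a
terminal vertex, and a length.  The graph is compact when `V` and `E` are finite. -/
structure MetricGraph (V E : Type*) where
  src : E → V
  tgt : E → V
  len : E → ℝ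
  len_pos : ∀ e, 0 < len e

/-- The integrable function `g` is a weak derivative of the integrable function `f` on
`(0, L)`. -/
def IsWeakDeriv (L : ℝ) (f g : ℝ → ℝ) : Prop :=
  IntegrableOn f (Ioo 0 L) ∧ IntegrableOn g (Ioo 0 L) ∧
    ∀ φ : ℝ → ℝ, ContDiff ℝ ∞ φ → HasCompactSupport φ → tsupport φ ⊆ Ioo 0 L →
      ∫ t in Ioo 0 L, f t * deriv φ t = - ∫ t in Ioo 0 L, g t * φ t

open Classical in
/-- The weak derivative of `f` on `(0, L)`, which is unique up to a null set (and `0` if there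
is none). -/
def weakDeriv (L : ℝ) (f : ℝ → ℝ) : ℝ → ℝ :=
  if h : ∃ g, IsWeakDeriv L f g then h.choose else 0

/-- `f ∈ W^{1,p}(0, L)`, for `1 ≤ p ≤ ∞`. -/
def MemSobolev (p : ℝ≥0∞) (L : ℝ) (f : ℝ → ℝ) : Prop :=
  MemLp f p (volume.restrict (Ioo 0 L)) ∧
    ∃ g, MemLp g p (volume.restrict (Ioo 0 L)) ∧ IsWeakDeriv L f g

theorem integrableOn_mul_test {L : ℝ} {f ψ : ℝ → ℝ} (hf : IntegrableOn f (Ioo 0 L))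
    (hψ : Continuous ψ) (hc : HasCompactSupport ψ) :
    IntegrableOn (fun t => f t * ψ t) (Ioo 0 L) := by
  obtain ⟨C, hC⟩ := hψ.bounded_above_of_compact_support hc
  exact Integrable.mul_bdd (c := C) hf hψ.aestronglyMeasurable (ae_of_all _ hC)

theorem MemSobolev.add {p : ℝ≥0∞} {L : ℝ} {f₁ f₂ : ℝ → ℝ}
    (h₁ : MemSobolev p L f₁) (h₂ : MemSobolev p L f₂) :
    MemSobolev p L (fun t => f₁ t + f₂ t) := by
  obtain ⟨hf₁, g₁, hg₁, hi₁, hj₁, hw₁⟩ := h₁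
  obtain ⟨hf₂, g₂, hg₂, hi₂, hj₂, hw₂⟩ := h₂
  refine ⟨hf₁.add hf₂, fun t => g₁ t + g₂ t, hg₁.add hg₂, hi₁.add hi₂, hj₁.add hj₂,
    fun φ hφ hc hs => ?_⟩
  have hd : Continuous (deriv φ) := hφ.continuous_deriv (by simp)
  simp only [add_mul]
  rw [integral_add (integrableOn_mul_test hi₁ hd hc.deriv)
      (integrableOn_mul_test hi₂ hd hc.deriv),
    integral_add (integrableOn_mul_test hj₁ hφ.continuous hc)
      (integrableOn_mul_test hj₂ hφ.continuous hc),
    hw₁ φ hφ hc hs, hw₂ φ hφ hc hs]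
  ring

theorem MemSobolev.const_mul {p : ℝ≥0∞} {L : ℝ} {f : ℝ → ℝ} (c : ℝ)
    (h : MemSobolev p L f) : MemSobolev p L (fun t => c * f t) := by
  obtain ⟨hf, g, hg, hi, hj, hw⟩ := h
  refine ⟨hf.const_mul c, fun t => c * g t, hg.const_mul c, Integrable.const_mul hi c,
    Integrable.const_mul hj c, fun φ hφ hc hs => ?_⟩
  simp only [mul_assoc, integral_const_mul]
  rw [hw φ hφ hc hs]
  ring

theorem MemSobolev.zero {p : ℝ≥0∞} {L : ℝ} : MemSobolev p L (fun _ => 0) :=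
  ⟨MemLp.zero, fun _ => 0, MemLp.zero, integrableOn_zero, integrableOn_zero,
    fun φ _ _ _ => by simp⟩

namespace MetricGraph

variable {V E : Type*} (G : MetricGraph V E)

/-- Any two vertices are joined by a walk. -/
def Connected : Prop :=
  ∀ v w : V, Relation.ReflTransGen
    (fun a b => ∃ e, (G.src e = a ∧ G.tgt e = b) ∨ (G.src e = b ∧ G.tgt e = a)) v w

/-- The vertices and the closed intervals `[0, ℓ_e]`, before gluing. -/
abbrev PrePoint : Type _ := V ⊕ (Σ e : E, Icc (0 : ℝ) (G.len e))

/-- The ends of the interval `[0, ℓ_e]` are glued to the end vertices of the edge `e`. -/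
inductive Glue : G.PrePoint → G.PrePoint → Prop
  | src (e : E) : Glue (Sum.inr ⟨e, 0, le_rfl, (G.len_pos e).le⟩) (Sum.inl (G.src e))
  | tgt (e : E) : Glue (Sum.inr ⟨e, G.len e, (G.len_pos e).le, le_rfl⟩) (Sum.inl (G.tgt e))

/-- The points of the metric graph (vertices and points of edges). -/
def Point : Type _ := Quot G.Glue

/-- The quotient topology. -/
instance : TopologicalSpace G.Point :=
  letI : TopologicalSpace V := ⊥
  inferInstanceAs (TopologicalSpace (Quot G.Glue))

/-- A vertex as a point of the graph. -/
def vertex (v : V) : G.Point := Quot.mk _ (Sum.inl v)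

/-- The point with coordinate `t` on the edge `e`. -/
def onEdge (e : E) (t : Icc (0 : ℝ) (G.len e)) : G.Point := Quot.mk _ (Sum.inr ⟨e, t⟩)

/-- `G.PathLength x y r`: there is a path of length `r` from `x` to `y`, made of finitely many
segments, each of which runs inside one edge. -/
inductive PathLength (x : G.Point) : G.Point → ℝ → Prop
  | refl : PathLength x x 0
  | step (e : E) (s t : Icc (0 : ℝ) (G.len e)) (r : ℝ) :
      PathLength x (G.onEdge e s) r →
        PathLength x (G.onEdge e t) (r + |(t : ℝ) - (s : ℝ)|)

/-- The distance of two points: the infimum of the lengths of the paths joining them. -/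
def pathDist (x y : G.Point) : ℝ := sInf {r | G.PathLength x y r}

/-- The distance from a point to a set of vertices. -/
def distTo (VD : Set V) (x : G.Point) : ℝ := sInf ((fun v => G.pathDist x (G.vertex v)) '' VD)

/-- The function `u_e` on the edge `e` (extended by constants outside `[0, ℓ_e]`). -/
def edgeFun (u : G.Point → ℝ) (e : E) (t : ℝ) : ℝ :=
  u (G.onEdge e (projIcc 0 (G.len e) (G.len_pos e).le t))

/-- The weak derivative `u'_e` of `u` on the edge `e`. -/
def edgeDeriv (u : G.Point → ℝ) (e : E) : ℝ → ℝ := weakDeriv (G.len e) (G.edgeFun u e)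

/-- The Sobolev space `W^{1,p}(Γ)`, `1 ≤ p ≤ ∞`: the continuous functions on `Γ` whose
restriction to every edge `e` is in `W^{1,p}(0, ℓ_e)`. -/
def sobolev (p : ℝ≥0∞) : Submodule ℝ (G.Point → ℝ) where
  carrier := {u | Continuous u ∧ ∀ e, MemSobolev p (G.len e) (G.edgeFun u e)}
  add_mem' := fun hu hv => ⟨hu.1.add hv.1, fun e => (hu.2 e).add (hv.2 e)⟩
  zero_mem' := ⟨continuous_const, fun _ => MemSobolev.zero⟩
  smul_mem' := fun c _ hu => ⟨hu.1.const_smul c, fun e => (hu.2 e).const_mul c⟩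

/-- The nonzero functions of `W^{1,p}(Γ)` that vanish on `VD`. -/
def competitors (p : ℝ≥0∞) (VD : Set V) : Set (G.Point → ℝ) :=
  {u | u ∈ G.sobolev p ∧ (∀ v ∈ VD, u (G.vertex v) = 0) ∧ u ≠ 0}

/-- `‖f‖_{L^∞(Γ)}` for a collection `f` of functions on the edges. -/
def supNorm (f : E → ℝ → ℝ) : ℝ :=
  (⨆ e, eLpNorm (f e) ∞ (volume.restrict (Ioo 0 (G.len e)))).toReal

/-- The quotient `‖v'‖_∞ / ‖v‖_∞`. -/
def supQuotient (v : G.Point → ℝ) : ℝ := G.supNorm (G.edgeDeriv v) / G.supNorm (G.edgeFun v)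

/-- `Λ_∞(Γ, VD)`. -/
def eigenInf (VD : Set V) : ℝ := sInf (G.supQuotient '' G.competitors ∞ VD)

/-- `v` is a minimizer for `Λ_∞(Γ, VD)`. -/
def IsMinimizerInf (VD : Set V) (v : G.Point → ℝ) : Prop :=
  v ∈ G.competitors ∞ VD ∧ G.supQuotient v = G.eigenInf VD

variable [Fintype E]

/-- `∫_Γ |f|^p` for a collection `f` of functions on the edges. -/
def intPow (p : ℝ) (f : E → ℝ → ℝ) : ℝ := ∑ e, ∫ t in Ioo 0 (G.len e), |f e t| ^ p

/-- `‖u‖_{L^p(Γ)}`, `p < ∞`. -/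
def lpNorm (p : ℝ) (u : G.Point → ℝ) : ℝ := (G.intPow p (G.edgeFun u)) ^ (1 / p)

/-- `‖u‖_{W^{1,p}(Γ)}`, `p < ∞`. -/
def sobolevNorm (p : ℝ) (u : G.Point → ℝ) : ℝ :=
  (G.intPow p (G.edgeFun u) + G.intPow p (G.edgeDeriv u)) ^ (1 / p)

/-- The quotient `∫_Γ |u'|^p / ∫_Γ |u|^p`. -/
def rayleigh (p : ℝ) (u : G.Point → ℝ) : ℝ :=
  G.intPow p (G.edgeDeriv u) / G.intPow p (G.edgeFun u)

/-- The first eigenvalue `λ_{1,p}(Γ, VD)`, `1 < p < ∞`. -/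
def firstEigenvalue (p : ℝ) (VD : Set V) : ℝ :=
  sInf (G.rayleigh p '' G.competitors (ENNReal.ofReal p) VD)

/-- `u` is a minimizer for `λ_{1,p}(Γ, VD)`. -/
def IsMinimizer (p : ℝ) (VD : Set V) (u : G.Point → ℝ) : Prop :=
  u ∈ G.competitors (ENNReal.ofReal p) VD ∧ G.rayleigh p u = G.firstEigenvalue p VD

/-- Weak convergence in `W^{1,q}(Γ)`, `1 ≤ q < ∞`, of a sequence that belongs to `W^{1,q}(Γ)` from
some index on: every bounded linear functional on `W^{1,q}(Γ)` converges along the sequence. -/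
def TendstoWeakly (q : ℝ) (us : ℕ → G.Point → ℝ) (u : G.Point → ℝ) : Prop :=
  ∃ (N : ℕ) (hN : ∀ j, us (j + N) ∈ G.sobolev (ENNReal.ofReal q))
    (h : u ∈ G.sobolev (ENNReal.ofReal q)),
    ∀ φ : G.sobolev (ENNReal.ofReal q) →ₗ[ℝ] ℝ,
      (∃ C : ℝ, ∀ w, |φ w| ≤ C * G.sobolevNorm q w) →
        Tendsto (fun j => φ ⟨us (j + N), hN j⟩) atTop (𝓝 (φ ⟨u, h⟩))

end MetricGraph

end

/-! Let `M` be the greatest distance to `VD`. Integrating along almost shortest paths, a function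
that is `K`-Lipschitz along the edges and vanishes on `VD` satisfies `|h| ≤ K * distTo VD ≤ K * M`
(`Connected.abs_le_mul_distTo`). So every quotient for `Λ_∞` is at least `1 / M`, and the distance
function, which is 1-Lipschitz, attains this value.

For finite `p` the distance function as a test function gives `λ_p ≤ k ^ p` for large `p` whenever
`k > 1 / M`. Conversely, let normalized competitors satisfy `∫|w'|^p ≤ k ^ p` along exponents
tending to infinity. By Arzelà–Ascoli some of them converge uniformly; the limit is `k`-Lipschitz
along the edges (`abs_sub_le_of_tendsto`), vanishes on `VD`, and reaches absolute value `1` because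
the `L^p` norms are `1` (`exists_one_le_abs_of_tendstoUniformly`). This forces `1 ≤ k * M`, hence
the lower bound on `λ_p`. The same limit properties make a uniform limit of normalized minimizers `1
/ M`-Lipschitz with a value of size at least `1`, thus a minimizer for `Λ_∞`.

The estimates rest on `a ^ r ≤ K ^ r * (1 + (a / K) ^ p)` for `r ≤ p`, used in place of Hölder's
inequality.

Weak convergence needs no reflexivity. If a bounded functional stayed `ε` above its value at the
uniform limit, so would it on convex combinations of the sequence. Clarkson's inequality provides
combinations of the tails that converge in norm to that same limit, a contradiction. -/

noncomputable section

/-! ### Weak derivatives on an interval -/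

section Interval

variable {L : ℝ} {f f₁ f₂ g g₁ g₂ : ℝ → ℝ}

theorem intervalIntegrable_of_integrableOn_Ioo (hg : IntegrableOn g (Ioo 0 L)) {s t : ℝ}
    (hs : s ∈ Icc 0 L) (ht : t ∈ Icc 0 L) : IntervalIntegrable g volume s t := by
  have h : IntegrableOn g (Icc 0 L) := by rwa [integrableOn_Icc_iff_integrableOn_Ioo]
  exact (h.mono_set (uIcc_subset_Icc hs ht)).intervalIntegrable

theorem setIntegral_Ioo_eq_intervalIntegral (hL : 0 < L) (f : ℝ → ℝ) :
    ∫ t in Ioo 0 L, f t = ∫ t in (0 : ℝ)..L, f t := by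
  rw [intervalIntegral.integral_of_le hL.le, integral_Ioc_eq_integral_Ioo]

theorem IsWeakDeriv.add (h₁ : IsWeakDeriv L f₁ g₁) (h₂ : IsWeakDeriv L f₂ g₂) :
    IsWeakDeriv L (fun t => f₁ t + f₂ t) (fun t => g₁ t + g₂ t) := by
  obtain ⟨hi₁, hj₁, hw₁⟩ := h₁
  obtain ⟨hi₂, hj₂, hw₂⟩ := h₂
  refine ⟨hi₁.add hi₂, hj₁.add hj₂, fun φ hφ hc hs => ?_⟩
  have hd : Continuous (deriv φ) := hφ.continuous_deriv (by simp)
  simp only [add_mul]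
  rw [integral_add (integrableOn_mul_test hi₁ hd hc.deriv)
      (integrableOn_mul_test hi₂ hd hc.deriv),
    integral_add (integrableOn_mul_test hj₁ hφ.continuous hc)
      (integrableOn_mul_test hj₂ hφ.continuous hc),
    hw₁ φ hφ hc hs, hw₂ φ hφ hc hs]
  ring

theorem IsWeakDeriv.const_mul (c : ℝ) (h : IsWeakDeriv L f g) :
    IsWeakDeriv L (fun t => c * f t) (fun t => c * g t) := by
  obtain ⟨hi, hj, hw⟩ := h
  refine ⟨Integrable.const_mul hi c, Integrable.const_mul hj c, fun φ hφ hc hs => ?_⟩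
  simp only [mul_assoc, integral_const_mul]
  rw [hw φ hφ hc hs]
  ring

theorem IsWeakDeriv.ae_unique (h₁ : IsWeakDeriv L f g₁) (h₂ : IsWeakDeriv L f g₂) :
    g₁ =ᵐ[volume.restrict (Ioo 0 L)] g₂ := by
  have key : ∀ᵐ x, x ∈ Ioo 0 L → g₁ x - g₂ x = 0 := by
    refine isOpen_Ioo.ae_eq_zero_of_integral_contDiff_smul_eq_zero (f := fun x => g₁ x - g₂ x)
      (IntegrableOn.locallyIntegrableOn (h₁.2.1.sub h₂.2.1)) fun φ hφ hc hs => ?_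
    have e : ∫ x, φ x • (g₁ x - g₂ x) = ∫ x in Ioo 0 L, (g₁ x * φ x - g₂ x * φ x) := by
      rw [← setIntegral_eq_integral_of_forall_compl_eq_zero (s := Ioo 0 L)]
      · exact integral_congr_ae (ae_of_all _ fun x => by simp; ring)
      · intro x hx
        rw [image_eq_zero_of_notMem_tsupport (fun h => hx (hs h)), zero_smul]
    rw [e, integral_sub (integrableOn_mul_test h₁.2.1 hφ.continuous hc)
      (integrableOn_mul_test h₂.2.1 hφ.continuous hc)]
    have := h₁.2.2 φ hφ hc hs
    have := h₂.2.2 φ hφ hc hs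
    linarith
  rw [Filter.EventuallyEq, ae_restrict_iff' measurableSet_Ioo]
  filter_upwards [key] with x hx hm
  linarith [hx hm]

theorem IsWeakDeriv.weakDeriv (h : IsWeakDeriv L f g) : IsWeakDeriv L f (weakDeriv L f) := by
  have h' : ∃ g, IsWeakDeriv L f g := ⟨g, h⟩
  rw [_root_.weakDeriv, dif_pos h']
  exact h'.choose_spec

/-- `weakDeriv` is an arbitrary choice; this identification with a concrete derivative is how it
gets computed later. -/
theorem IsWeakDeriv.weakDeriv_ae_eq (h : IsWeakDeriv L f g) :
    _root_.weakDeriv L f =ᵐ[volume.restrict (Ioo 0 L)] g :=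
  h.weakDeriv.ae_unique h

/-- A primitive of an integrable function has that function as its weak derivative. -/
theorem isWeakDeriv_of_forall_eq_add_integral (hL : 0 < L) (hg : IntegrableOn g (Ioo 0 L))
    (h : ∀ t ∈ Icc 0 L, f t = f 0 + ∫ s in (0 : ℝ)..t, g s) : IsWeakDeriv L f g := by
  have h0 : (0 : ℝ) ∈ Icc 0 L := ⟨le_rfl, hL.le⟩
  have hL' : L ∈ Icc 0 L := ⟨hL.le, le_rfl⟩
  have hgi := intervalIntegrable_of_integrableOn_Ioo hg h0 hL'
  -- `f` is controlled only on `[0, L]`, so it is replaced by the absolutely continuous primitive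
  -- `F`, for which integration by parts is available. The boundary terms vanish with `φ`.
  set F : ℝ → ℝ := fun t => (∫ s in (0 : ℝ)..t, g s) + f 0 with hF
  have hFac : AbsolutelyContinuousOnInterval F 0 L :=
    (hgi.absolutelyContinuousOnInterval_intervalIntegral (c := 0) (by simp)).add
      ((LipschitzWith.const (f 0)).lipschitzOnWith.absolutelyContinuousOnInterval)
  have hfF : ∀ t ∈ Icc 0 L, f t = F t := fun t ht => by rw [h t ht, hF, add_comm]
  have hFc : ContinuousOn F (Icc 0 L) := by simpa [uIcc_of_le hL.le] using hFac.continuousOn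
  refine ⟨?_, hg, fun φ hφ hc hs => ?_⟩
  · have : IntegrableOn F (Ioo 0 L) := (hFc.integrableOn_Icc).mono_set Ioo_subset_Icc_self
    exact this.congr_fun (fun t ht => (hfF t (Ioo_subset_Icc_self ht)).symm) measurableSet_Ioo
  · have hφac : AbsolutelyContinuousOnInterval φ 0 L :=
      (hφ.of_le (by simp)).contDiffOn.absolutelyContinuousOnInterval
    have hz : ∀ x, x ∉ Ioo 0 L → φ x = 0 := fun x hx =>
      image_eq_zero_of_notMem_tsupport fun h => hx (hs h)
    rw [setIntegral_Ioo_eq_intervalIntegral hL, setIntegral_Ioo_eq_intervalIntegral hL]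
    have e1 : ∫ t in (0 : ℝ)..L, f t * deriv φ t = ∫ t in (0 : ℝ)..L, F t * deriv φ t := by
      refine intervalIntegral.integral_congr fun t ht => ?_
      rw [uIcc_of_le hL.le] at ht
      simp only [hfF t ht]
    rw [e1, hFac.integral_mul_deriv_eq_deriv_mul hφac, hz 0 (by simp), hz L (by simp)]
    have e2 : ∫ t in (0 : ℝ)..L, deriv F t * φ t = ∫ t in (0 : ℝ)..L, g t * φ t := by
      refine intervalIntegral.integral_congr_ae ?_
      filter_upwards [hgi.ae_hasDerivAt_integral] with x hx hx'
      have := ((hx (uIoc_subset_uIcc hx') 0 (by simp)).add_const (f 0)).deriv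
      rw [hF, this]
    rw [e2]
    ring

/-- A test function of integral zero has a test function as its primitive. -/
theorem exists_test_primitive {h : ℝ → ℝ} (hh : ContDiff ℝ ∞ h)
    {a b : ℝ} (ha : 0 < a) (hb : b < L) (hs : tsupport h ⊆ Icc a b)
    (hint : ∫ x, h x = 0) :
    ∃ φ : ℝ → ℝ, ContDiff ℝ ∞ φ ∧ HasCompactSupport φ ∧ tsupport φ ⊆ Ioo 0 L ∧
      deriv φ = h := by
  set φ : ℝ → ℝ := fun t => ∫ s in (0 : ℝ)..t, h s with hφ
  have hd : ∀ t, HasDerivAt φ (h t) t := fun t =>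
    intervalIntegral.integral_hasDerivAt_right (hh.continuous.intervalIntegrable _ _)
      hh.continuous.stronglyMeasurable.stronglyMeasurableAtFilter hh.continuous.continuousAt
  have hder : deriv φ = h := funext fun t => (hd t).deriv
  have hz : ∀ x, x ∉ Icc a b → h x = 0 := fun x hx =>
    image_eq_zero_of_notMem_tsupport fun h => hx (hs h)
  -- To the left of `a` the integrand vanishes; to the right of `b` the primitive equals the total
  -- integral, which is zero.
  have hsupp : Function.support φ ⊆ Icc a b := by
    intro t ht
    by_contra hn
    apply ht
    rcases lt_or_ge t a with h1 | h1
    · have : ∫ s in (0 : ℝ)..t, h s = ∫ s in (0 : ℝ)..t, (0 : ℝ) := by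
        refine intervalIntegral.integral_congr fun s hs' => hz s fun hs2 => ?_
        rcases le_total 0 t with h0 | h0
        · rw [uIcc_of_le h0] at hs'; linarith [hs'.2, hs2.1]
        · rw [uIcc_of_ge h0] at hs'; linarith [hs'.2, hs2.1]
      simp [hφ, this]
    · have h2 : b < t := by
        by_contra h3
        exact hn ⟨h1, not_lt.mp h3⟩
      simp only [hφ]
      rw [intervalIntegral.integral_eq_integral_of_support_subset, hint]
      intro x hx
      have hx' : x ∈ Icc a b := hs (subset_tsupport _ hx)
      exact ⟨ha.trans_le hx'.1, hx'.2.trans h2.le⟩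
  have hts : tsupport φ ⊆ Icc a b := closure_minimal hsupp isClosed_Icc
  refine ⟨φ, contDiff_infty_iff_deriv.mpr ⟨fun t => (hd t).differentiableAt, hder ▸ hh⟩,
    isCompact_Icc.of_isClosed_subset (isClosed_tsupport _) hts,
    hts.trans (fun x hx => ⟨ha.trans_le hx.1, hx.2.trans_lt hb⟩), hder⟩

/-- A function with weak derivative zero is almost everywhere constant. -/
theorem IsWeakDeriv.ae_const_of_zero (hL : 0 < L) (h : IsWeakDeriv L f fun _ => 0) :
    ∃ c, ∀ᵐ x, x ∈ Ioo 0 L → f x = c := by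
  -- Du Bois-Reymond: let `ρ` be a test function of integral one. If `ψ` has integral `k`, then `ψ -
  -- k * ρ` has integral zero and is the derivative of a test function, so `∫ f ψ = k * ∫ f ρ`. Thus
  -- `f - c` with `c = ∫ f ρ` annihilates every `ψ`.
  let η : ContDiffBump (L / 2) := ⟨L / 8, L / 4, by positivity, by linarith⟩
  set ρ : ℝ → ℝ := η.normed volume
  have hρ : ContDiff ℝ ∞ ρ := η.contDiff_normed
  have hρc : HasCompactSupport ρ := η.hasCompactSupport_normed
  have hρi : ∫ x, ρ x = 1 := η.integral_normed
  have hρs : tsupport ρ ⊆ Ioo 0 L := by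
    rw [η.tsupport_normed_eq, Real.closedBall_eq_Icc]
    intro x hx
    have h1 := hx.1
    have h2 := hx.2
    simp only [η] at h1 h2
    constructor <;> linarith
  have hz : ∀ {ψ : ℝ → ℝ}, tsupport ψ ⊆ Ioo 0 L → ∀ x, x ∉ Ioo 0 L → ψ x = 0 := fun hs x hx =>
    image_eq_zero_of_notMem_tsupport fun h => hx (hs h)
  refine ⟨∫ t in Ioo 0 L, f t * ρ t, ?_⟩
  set c := ∫ t in Ioo 0 L, f t * ρ t
  have hfi : IntegrableOn (fun x => f x - c) (Ioo 0 L) := h.1.sub (by simp)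
  have key : ∀ᵐ x, x ∈ Ioo 0 L → f x - c = 0 := by
    refine isOpen_Ioo.ae_eq_zero_of_integral_contDiff_smul_eq_zero
      (f := fun x => f x - c) hfi.locallyIntegrableOn fun ψ hψ hψc hψs => ?_
    set k := ∫ x, ψ x
    have hKc : IsCompact (tsupport ψ ∪ tsupport ρ) := hψc.isCompact.union hρc.isCompact
    have hKn : (tsupport ψ ∪ tsupport ρ).Nonempty := by
      refine Set.Nonempty.inr ?_
      by_contra hne
      have : ρ = 0 := tsupport_eq_empty_iff.mp (not_nonempty_iff_eq_empty.mp hne)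
      simp [this] at hρi
    have hKs : tsupport ψ ∪ tsupport ρ ⊆ Ioo 0 L := union_subset hψs hρs
    obtain ⟨a, ha⟩ := hKc.exists_isLeast hKn
    obtain ⟨b, hb⟩ := hKc.exists_isGreatest hKn
    obtain ⟨φ, hφ, hφc, hφs, hφd⟩ := exists_test_primitive (L := L)
      (h := fun x => ψ x - k * ρ x) (hψ.sub (contDiff_const.mul hρ)) (hKs ha.1).1 (hKs hb.1).2
      (by
        refine closure_minimal (fun x hx => ?_) isClosed_Icc
        have : x ∈ tsupport ψ ∪ tsupport ρ := by
          by_contra hn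
          rw [mem_union, not_or] at hn
          apply hx
          simp [image_eq_zero_of_notMem_tsupport hn.1, image_eq_zero_of_notMem_tsupport hn.2]
        exact ⟨ha.2 this, hb.2 this⟩) (by
        rw [integral_sub (hψ.continuous.integrable_of_hasCompactSupport hψc)
          ((hρ.continuous.integrable_of_hasCompactSupport hρc).const_mul k),
          integral_const_mul, hρi]
        simp [k])
    have hw := h.2.2 φ hφ hφc hφs
    rw [hφd] at hw
    simp only [zero_mul, integral_zero, neg_zero, mul_sub] at hw
    have i1 := integrableOn_mul_test h.1 hψ.continuous hψc
    have i2 := integrableOn_mul_test h.1 hρ.continuous hρc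
    have e3 : ∀ t, f t * (k * ρ t) = k * (f t * ρ t) := fun t => by ring
    simp only [e3] at hw
    rw [integral_sub i1 (i2.const_mul k), integral_const_mul] at hw
    have e : ∫ x, ψ x • (f x - c) = ∫ x in Ioo 0 L, (f x * ψ x - c * ψ x) := by
      rw [← setIntegral_eq_integral_of_forall_compl_eq_zero (s := Ioo 0 L)]
      · exact integral_congr_ae (ae_of_all _ fun x => by simp; ring)
      · intro x hx
        rw [hz hψs x hx, zero_smul]
    have ek : ∫ x in Ioo 0 L, ψ x = k :=
      setIntegral_eq_integral_of_forall_compl_eq_zero (hz hψs)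
    rw [e, integral_sub i1
      ((hψ.continuous.integrable_of_hasCompactSupport hψc).integrableOn.const_mul c),
      integral_const_mul, ek]
    change _ - k * c = 0 at hw
    linarith
  filter_upwards [key] with x hx hm
  linarith [hx hm]

/-- A continuous function is a primitive of its weak derivative. -/
theorem IsWeakDeriv.integral_eq_sub (hL : 0 < L) (hf : ContinuousOn f (Icc 0 L))
    (h : IsWeakDeriv L f g) {s t : ℝ} (hs : s ∈ Icc 0 L) (ht : t ∈ Icc 0 L) :
    ∫ x in s..t, g x = f t - f s := by
  have h0 : (0 : ℝ) ∈ Icc 0 L := ⟨le_rfl, hL.le⟩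
  have hL' : L ∈ Icc 0 L := ⟨hL.le, le_rfl⟩
  have hgi := intervalIntegrable_of_integrableOn_Ioo h.2.1 h0 hL'
  have hGc : ContinuousOn (fun t => ∫ s in (0 : ℝ)..t, g s) (Icc 0 L) := by
    have := (hgi.absolutelyContinuousOnInterval_intervalIntegral (c := 0) (by simp)).continuousOn
    simpa [uIcc_of_le hL.le] using this
  -- The difference of `f` and the primitive of `g` has weak derivative zero. It is constant almost
  -- everywhere and, by continuity, on all of `[0, L]`.
  have hG : IsWeakDeriv L (fun t => ∫ s in (0 : ℝ)..t, g s) g :=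
    isWeakDeriv_of_forall_eq_add_integral hL h.2.1 (by simp)
  have hz := (h.add (hG.const_mul (-1)))
  have hz' : IsWeakDeriv L (fun t => f t + -1 * ∫ s in (0 : ℝ)..t, g s) fun _ => 0 := by
    convert hz using 2
    ring
  obtain ⟨c, hc⟩ := hz'.ae_const_of_zero hL
  have hcont : ContinuousOn (fun t => f t + -1 * ∫ s in (0 : ℝ)..t, g s) (Icc 0 L) :=
    hf.add (continuousOn_const.mul hGc)
  have hae : (fun t => f t + -1 * ∫ s in (0 : ℝ)..t, g s)
      =ᵐ[volume.restrict (Icc 0 L)] fun _ => c := by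
    rw [← restrict_Ioo_eq_restrict_Icc, Filter.EventuallyEq, ae_restrict_iff' measurableSet_Ioo]
    exact hc
  have heq := Measure.eqOn_Icc_of_ae_eq volume hL.ne hae hcont continuousOn_const
  have e1 := heq hs
  have e2 := heq ht
  simp only at e1 e2
  rw [← intervalIntegral.integral_interval_sub_left
    (intervalIntegrable_of_integrableOn_Ioo h.2.1 h0 ht)
    (intervalIntegrable_of_integrableOn_Ioo h.2.1 h0 hs)]
  linarith

/-- A Lipschitz function has a weak derivative bounded by the Lipschitz constant. -/
theorem LipschitzWith.isWeakDeriv_deriv (hL : 0 < L) {K : NNReal} (hf : LipschitzWith K f) :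
    IsWeakDeriv L f (deriv f) := by
  have hac : ∀ t, AbsolutelyContinuousOnInterval f 0 t := fun t =>
    hf.lipschitzOnWith.absolutelyContinuousOnInterval
  refine isWeakDeriv_of_forall_eq_add_integral hL ?_ fun t _ => ?_
  · have := (hac L).intervalIntegrable_deriv
    rw [intervalIntegrable_iff_integrableOn_Ioo_of_le hL.le] at this
    exact this
  · rw [(hac t).integral_deriv_eq_sub]
    ring

end Interval

end

/-! ### Paths, the distance to `VD`, and functions Lipschitz along the edges -/

noncomputable section

namespace MetricGraph

variable {V E : Type*} (G : MetricGraph V E)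

theorem onEdge_zero (e : E) :
    G.onEdge e ⟨0, le_rfl, (G.len_pos e).le⟩ = G.vertex (G.src e) := Quot.sound (Glue.src e)

theorem onEdge_len (e : E) :
    G.onEdge e ⟨G.len e, (G.len_pos e).le, le_rfl⟩ = G.vertex (G.tgt e) := Quot.sound (Glue.tgt e)

/-- The gluing map. -/
def glueMap (a : G.PrePoint) : G.Point := Quot.mk _ a

theorem isQuotientMap_mk :
    letI : TopologicalSpace V := ⊥
    IsQuotientMap G.glueMap :=
  let _ : TopologicalSpace V := ⊥
  isQuotientMap_quot_mk

theorem continuous_onEdge (e : E) : Continuous (G.onEdge e) := by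
  let _ : TopologicalSpace V := ⊥
  exact G.isQuotientMap_mk.continuous.comp (continuous_inr.comp continuous_sigmaMk)

variable {G} in
/-- A function on the graph is continuous when it is so along every edge. -/
theorem continuous_of_forall_onEdge {X : Type*} [TopologicalSpace X] {u : G.Point → X}
    (h : ∀ e, Continuous fun t => u (G.onEdge e t)) : Continuous u := by
  let _ : TopologicalSpace V := ⊥
  have : DiscreteTopology V := ⟨rfl⟩
  rw [G.isQuotientMap_mk.continuous_iff, continuous_sum_dom]
  exact ⟨continuous_of_discreteTopology, continuous_sigma h⟩

instance [Finite V] [Finite E] : CompactSpace G.Point := by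
  let _ : TopologicalSpace V := ⊥
  exact inferInstanceAs (CompactSpace (Quot G.Glue))

variable {G}

theorem PathLength.nonneg {x y : G.Point} {r : ℝ} (h : G.PathLength x y r) : 0 ≤ r := by
  induction h with
  | refl => rfl
  | step e s t r _ ih => positivity

theorem PathLength.trans {x y z : G.Point} {r r' : ℝ} (h : G.PathLength x y r)
    (h' : G.PathLength y z r') : G.PathLength x z (r + r') := by
  induction h' with
  | refl => simpa using h
  | step e s t r₁ _ ih =>
    rw [← add_assoc]
    exact ih.step e s t _

theorem pathLength_onEdge (e : E) (s t : Icc (0 : ℝ) (G.len e)) :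
    G.PathLength (G.onEdge e s) (G.onEdge e t) |(t : ℝ) - s| := by
  simpa using PathLength.refl.step e s t 0

theorem PathLength.symm {x y : G.Point} {r : ℝ} (h : G.PathLength x y r) :
    G.PathLength y x r := by
  induction h with
  | refl => exact .refl
  | step e s t r _ ih =>
    rw [add_comm, abs_sub_comm]
    exact (pathLength_onEdge e t s).trans ih

theorem PathLength.abs_sub_le {h : G.Point → ℝ} {K : ℝ}
    (hK : ∀ e s t, |h (G.onEdge e t) - h (G.onEdge e s)| ≤ K * |(t : ℝ) - s|)
    {x y : G.Point} {r : ℝ} (hp : G.PathLength x y r) : |h y - h x| ≤ K * r := by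
  induction hp with
  | refl => simp
  | step e s t r _ ih =>
    calc |h (G.onEdge e t) - h x|
        ≤ |h (G.onEdge e t) - h (G.onEdge e s)| + |h (G.onEdge e s) - h x| := _root_.abs_sub_le _ _ _
      _ ≤ K * |(t : ℝ) - s| + K * r := add_le_add (hK e s t) ih
      _ = K * (r + |(t : ℝ) - s|) := by ring

/-- A walk from `v` to an end of some edge is either empty or begins with an edge at `v`. Hence the
edges cover the graph and pointwise statements may be checked along edges. -/
theorem Connected.exists_incident [Nonempty E] (hG : G.Connected) (v : V) :
    ∃ e, G.src e = v ∨ G.tgt e = v := by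
  obtain ⟨e₀⟩ := ‹Nonempty E›
  rcases (hG v (G.src e₀)).cases_head with h | ⟨w, ⟨e, he⟩, _⟩
  · exact ⟨e₀, Or.inl h.symm⟩
  · exact ⟨e, he.imp And.left And.right⟩

theorem Connected.exists_onEdge [Nonempty E] (hG : G.Connected) (x : G.Point) :
    ∃ e t, x = G.onEdge e t := by
  induction x using Quot.ind with
  | mk a =>
    rcases a with v | ⟨e, t⟩
    · obtain ⟨e, rfl | rfl⟩ := hG.exists_incident v
      · exact ⟨e, _, (G.onEdge_zero e).symm⟩
      · exact ⟨e, _, (G.onEdge_len e).symm⟩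
    · exact ⟨e, t, rfl⟩

theorem Connected.exists_pathLength [Nonempty E] (hG : G.Connected) (x y : G.Point) :
    ∃ r, G.PathLength x y r := by
  have key : ∀ v w : V, ∃ r, G.PathLength (G.vertex v) (G.vertex w) r := by
    intro v w
    induction hG v w with
    | refl => exact ⟨0, .refl⟩
    | tail _ h ih =>
      obtain ⟨r, hr⟩ := ih
      obtain ⟨e, ⟨rfl, rfl⟩ | ⟨rfl, rfl⟩⟩ := h
      · rw [← onEdge_zero] at hr
        rw [← onEdge_len]
        exact ⟨_, hr.step e _ _ _⟩
      · rw [← onEdge_len] at hr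
        rw [← onEdge_zero]
        exact ⟨_, hr.step e _ _ _⟩
  obtain ⟨e, t, rfl⟩ := hG.exists_onEdge x
  obtain ⟨e', t', rfl⟩ := hG.exists_onEdge y
  obtain ⟨r, hr⟩ := key (G.src e) (G.src e')
  rw [← onEdge_zero, ← onEdge_zero] at hr
  exact ⟨_, ((pathLength_onEdge e t _).trans hr).step e' _ t' _⟩

theorem pathDist_le {x y : G.Point} {r : ℝ} (h : G.PathLength x y r) : G.pathDist x y ≤ r :=
  csInf_le ⟨0, fun _ h => h.nonneg⟩ h

theorem pathDist_nonneg (x y : G.Point) : 0 ≤ G.pathDist x y :=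
  Real.sInf_nonneg fun _ h => h.nonneg

theorem distTo_nonneg (VD : Set V) (x : G.Point) : 0 ≤ G.distTo VD x := by
  refine Real.sInf_nonneg ?_
  rintro _ ⟨v, _, rfl⟩
  exact pathDist_nonneg _ _

theorem distTo_le {VD : Set V} {v : V} (hv : v ∈ VD) {x : G.Point} {r : ℝ}
    (h : G.PathLength x (G.vertex v) r) : G.distTo VD x ≤ r := by
  refine (csInf_le ⟨0, ?_⟩ (mem_image_of_mem _ hv)).trans (pathDist_le h)
  rintro _ ⟨v, _, rfl⟩
  exact pathDist_nonneg _ _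

theorem distTo_vertex {VD : Set V} {v : V} (hv : v ∈ VD) : G.distTo VD (G.vertex v) = 0 :=
  le_antisymm (distTo_le hv .refl) (distTo_nonneg _ _)

theorem continuous_of_lipschitz {h : G.Point → ℝ} {K : ℝ} (hK0 : 0 ≤ K)
    (hK : ∀ e s t, |h (G.onEdge e t) - h (G.onEdge e s)| ≤ K * |(t : ℝ) - s|) :
    Continuous h :=
  continuous_of_forall_onEdge fun e =>
    (LipschitzWith.of_dist_le_mul (K := ⟨K, hK0⟩) fun t s => hK e s t).continuous

variable [Nonempty E] {VD : Set V}

/-- Almost shortest paths to the set. -/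
theorem Connected.exists_path_lt_distTo_add (hG : G.Connected) (hVD : VD.Nonempty) (x : G.Point)
    {ε : ℝ} (hε : 0 < ε) :
    ∃ v ∈ VD, ∃ r, G.PathLength x (G.vertex v) r ∧ r < G.distTo VD x + ε := by
  obtain ⟨_, ⟨v, hv, rfl⟩, h1⟩ := exists_lt_of_csInf_lt
    (hVD.image fun v => G.pathDist x (G.vertex v)) (lt_add_of_pos_right _ hε)
  obtain ⟨r, hr, h2⟩ := exists_lt_of_csInf_lt (hG.exists_pathLength x (G.vertex v)) h1
  exact ⟨v, hv, r, hr, h2⟩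

theorem Connected.distTo_le_add (hG : G.Connected) (hVD : VD.Nonempty) {x y : G.Point} {r : ℝ}
    (h : G.PathLength x y r) : G.distTo VD x ≤ r + G.distTo VD y := by
  refine le_of_forall_pos_le_add fun ε hε => ?_
  obtain ⟨v, hv, r', hr', h2⟩ := hG.exists_path_lt_distTo_add hVD y hε
  have := distTo_le hv (h.trans hr')
  linarith

theorem Connected.abs_distTo_sub_le (hG : G.Connected) (hVD : VD.Nonempty) (e : E)
    (s t : Icc (0 : ℝ) (G.len e)) :
    |G.distTo VD (G.onEdge e t) - G.distTo VD (G.onEdge e s)| ≤ 1 * |(t : ℝ) - s| := by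
  have h1 := hG.distTo_le_add hVD (pathLength_onEdge e s t)
  have h2 := hG.distTo_le_add hVD (pathLength_onEdge e s t).symm
  rw [one_mul, abs_le]
  constructor <;> linarith

/-- A function that is Lipschitz along the edges and vanishes on `VD` is bounded in terms of the
distance to `VD`. -/
theorem Connected.abs_le_mul_distTo (hG : G.Connected) (hVD : VD.Nonempty) {h : G.Point → ℝ}
    {K : ℝ} (hK0 : 0 ≤ K)
    (hK : ∀ e s t, |h (G.onEdge e t) - h (G.onEdge e s)| ≤ K * |(t : ℝ) - s|)
    (h0 : ∀ v ∈ VD, h (G.vertex v) = 0) (x : G.Point) : |h x| ≤ K * G.distTo VD x := by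
  refine le_of_forall_pos_le_add fun ε hε => ?_
  -- `K` may be zero, so the error is divided by `K + 1`.
  obtain ⟨v, hv, r, hr, h2⟩ := hG.exists_path_lt_distTo_add hVD x
    (show 0 < ε / (K + 1) by positivity)
  have h3 := hr.abs_sub_le hK
  rw [h0 v hv, zero_sub, abs_neg] at h3
  have h4 : K * (ε / (K + 1)) ≤ ε := by
    rw [mul_div_assoc', div_le_iff₀ (by positivity)]
    nlinarith
  nlinarith [mul_le_mul_of_nonneg_left h2.le hK0]

end MetricGraph

end

/-! ### Sobolev functions on the graph, sup norms and integrals of powers -/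

noncomputable section

namespace MetricGraph

variable {V E : Type*} {G : MetricGraph V E}

theorem edgeFun_coe (u : G.Point → ℝ) (e : E) (t : Icc (0 : ℝ) (G.len e)) :
    G.edgeFun u e t = u (G.onEdge e t) := by
  rw [edgeFun, projIcc_val]

theorem continuous_edgeFun {u : G.Point → ℝ} (hu : Continuous u) (e : E) :
    Continuous (G.edgeFun u e) :=
  hu.comp ((G.continuous_onEdge e).comp continuous_projIcc)

theorem memLp_edgeFun {u : G.Point → ℝ} (hu : Continuous u) (e : E) (p : ℝ≥0∞) :
    MemLp (G.edgeFun u e) p (volume.restrict (Ioo 0 (G.len e))) := by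
  obtain ⟨C, hC⟩ := isCompact_Icc.exists_bound_of_continuousOn (s := Icc 0 (G.len e))
    (continuous_edgeFun hu e).continuousOn
  refine MemLp.of_bound (continuous_edgeFun hu e).aestronglyMeasurable C ?_
  rw [ae_restrict_iff' measurableSet_Ioo]
  exact ae_of_all _ fun t ht => hC t (Ioo_subset_Icc_self ht)

theorem mem_sobolev_of_isWeakDeriv {u : G.Point → ℝ} {p : ℝ≥0∞} (hu : Continuous u)
    {g : E → ℝ → ℝ} (hg : ∀ e, MemLp (g e) p (volume.restrict (Ioo 0 (G.len e))))
    (h : ∀ e, IsWeakDeriv (G.len e) (G.edgeFun u e) (g e)) : u ∈ G.sobolev p :=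
  ⟨hu, fun e => ⟨memLp_edgeFun hu e p, g e, hg e, h e⟩⟩

theorem isWeakDeriv_edgeDeriv {u : G.Point → ℝ} {p : ℝ≥0∞} (hu : u ∈ G.sobolev p) (e : E) :
    IsWeakDeriv (G.len e) (G.edgeFun u e) (G.edgeDeriv u e) := by
  obtain ⟨g, _, h⟩ := (hu.2 e).2
  exact h.weakDeriv

theorem memLp_edgeDeriv {u : G.Point → ℝ} {p : ℝ≥0∞} (hu : u ∈ G.sobolev p) (e : E) :
    MemLp (G.edgeDeriv u e) p (volume.restrict (Ioo 0 (G.len e))) := by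
  obtain ⟨g, hg, h⟩ := (hu.2 e).2
  exact hg.ae_eq h.weakDeriv_ae_eq.symm

theorem sobolev_mono {p q : ℝ≥0∞} (h : q ≤ p) : G.sobolev p ≤ G.sobolev q := fun _ hu =>
  mem_sobolev_of_isWeakDeriv hu.1 (fun e => (memLp_edgeDeriv hu e).mono_exponent h)
    (isWeakDeriv_edgeDeriv hu)

theorem sub_eq_integral_edgeDeriv {u : G.Point → ℝ} {p : ℝ≥0∞} (hu : u ∈ G.sobolev p) (e : E)
    (s t : Icc (0 : ℝ) (G.len e)) :
    u (G.onEdge e t) - u (G.onEdge e s) = ∫ x in (s : ℝ)..t, G.edgeDeriv u e x := by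
  rw [(isWeakDeriv_edgeDeriv hu e).integral_eq_sub (G.len_pos e)
    (continuous_edgeFun hu.1 e).continuousOn s.2 t.2, edgeFun_coe, edgeFun_coe]

theorem edgeDeriv_add_ae {u v : G.Point → ℝ} {p : ℝ≥0∞} (hu : u ∈ G.sobolev p)
    (hv : v ∈ G.sobolev p) (e : E) :
    G.edgeDeriv (u + v) e =ᵐ[volume.restrict (Ioo 0 (G.len e))]
      fun t => G.edgeDeriv u e t + G.edgeDeriv v e t :=
  ((isWeakDeriv_edgeDeriv hu e).add (isWeakDeriv_edgeDeriv hv e)).weakDeriv_ae_eq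

theorem edgeDeriv_smul_ae {u : G.Point → ℝ} {p : ℝ≥0∞} (hu : u ∈ G.sobolev p) (c : ℝ) (e : E) :
    G.edgeDeriv (c • u) e =ᵐ[volume.restrict (Ioo 0 (G.len e))]
      fun t => c * G.edgeDeriv u e t :=
  ((isWeakDeriv_edgeDeriv hu e).const_mul c).weakDeriv_ae_eq

theorem lipschitzWith_edgeFun {u : G.Point → ℝ} {K : ℝ} (hK0 : 0 ≤ K)
    (hK : ∀ e s t, |u (G.onEdge e t) - u (G.onEdge e s)| ≤ K * |(t : ℝ) - s|) (e : E) :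
    LipschitzWith ⟨K, hK0⟩ (G.edgeFun u e) := by
  have h1 : LipschitzWith ⟨K, hK0⟩ fun t => u (G.onEdge e t) :=
    LipschitzWith.of_dist_le_mul fun t s => hK e s t
  have h2 := h1.comp (LipschitzWith.projIcc (G.len_pos e).le)
  exact (mul_one (⟨K, hK0⟩ : NNReal)) ▸ h2

theorem abs_edgeDeriv_le_of_lipschitz {u : G.Point → ℝ} {K : ℝ} (hK0 : 0 ≤ K)
    (hK : ∀ e s t, |u (G.onEdge e t) - u (G.onEdge e s)| ≤ K * |(t : ℝ) - s|) (e : E) :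
    ∀ᵐ t ∂volume.restrict (Ioo 0 (G.len e)), |G.edgeDeriv u e t| ≤ K := by
  have hl := lipschitzWith_edgeFun hK0 hK e
  filter_upwards [(hl.isWeakDeriv_deriv (G.len_pos e)).weakDeriv_ae_eq] with t ht
  rw [edgeDeriv, ht]
  exact norm_deriv_le_of_lipschitz hl

theorem mem_sobolev_of_lipschitz {u : G.Point → ℝ} {K : ℝ} (hK0 : 0 ≤ K)
    (hK : ∀ e s t, |u (G.onEdge e t) - u (G.onEdge e s)| ≤ K * |(t : ℝ) - s|) (p : ℝ≥0∞) :
    u ∈ G.sobolev p := by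
  refine mem_sobolev_of_isWeakDeriv (continuous_of_lipschitz hK0 hK) (g := fun e =>
    deriv (G.edgeFun u e)) (fun e => ?_)
    fun e => (lipschitzWith_edgeFun hK0 hK e).isWeakDeriv_deriv (G.len_pos e)
  exact MemLp.of_bound (measurable_deriv _).aestronglyMeasurable K
    (ae_of_all _ fun t => norm_deriv_le_of_lipschitz (lipschitzWith_edgeFun hK0 hK e))

/-- A bound on the weak derivative is a Lipschitz constant along the edges. -/
theorem abs_sub_le_of_abs_edgeDeriv_le {u : G.Point → ℝ} {p : ℝ≥0∞} (hu : u ∈ G.sobolev p)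
    {K : ℝ} {e : E} (hK : ∀ᵐ t ∂volume.restrict (Ioo 0 (G.len e)), |G.edgeDeriv u e t| ≤ K)
    (s t : Icc (0 : ℝ) (G.len e)) :
    |u (G.onEdge e t) - u (G.onEdge e s)| ≤ K * |(t : ℝ) - s| := by
  rw [sub_eq_integral_edgeDeriv hu]
  rw [restrict_Ioo_eq_restrict_Ioc, ae_restrict_iff' measurableSet_Ioc] at hK
  rw [← Real.norm_eq_abs]
  refine intervalIntegral.norm_integral_le_of_norm_le_const_ae ?_
  filter_upwards [hK] with x hx hm
  refine hx ⟨?_, ?_⟩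
  · exact (le_min s.2.1 t.2.1).trans_lt hm.1
  · exact hm.2.trans (max_le s.2.2 t.2.2)

theorem supNorm_nonneg (f : E → ℝ → ℝ) : 0 ≤ G.supNorm f := ENNReal.toReal_nonneg

theorem supNorm_le {f : E → ℝ → ℝ} {K : ℝ} (hK0 : 0 ≤ K)
    (h : ∀ e, ∀ᵐ t ∂volume.restrict (Ioo 0 (G.len e)), |f e t| ≤ K) : G.supNorm f ≤ K := by
  refine ENNReal.toReal_le_of_le_ofReal hK0 (iSup_le fun e => ?_)
  rw [eLpNorm_exponent_top]
  exact eLpNormEssSup_le_of_ae_bound (h e)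

theorem ae_abs_le_supNorm [Finite E] {f : E → ℝ → ℝ}
    (h : ∀ e, MemLp (f e) ∞ (volume.restrict (Ioo 0 (G.len e)))) (e : E) :
    ∀ᵐ t ∂volume.restrict (Ioo 0 (G.len e)), |f e t| ≤ G.supNorm f := by
  -- The supremum must be finite, since `toReal` sends `⊤` to `0`; this is where finiteness of `E`
  -- enters.
  have hfin : (⨆ e, eLpNorm (f e) ∞ (volume.restrict (Ioo 0 (G.len e)))) ≠ ⊤ := by
    have : Nonempty E := ⟨e⟩
    obtain ⟨e', he'⟩ := exists_eq_ciSup_of_finite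
      (f := fun e => eLpNorm (f e) ∞ (volume.restrict (Ioo 0 (G.len e))))
    rw [← he']
    exact (h e').2.ne
  filter_upwards [ae_le_eLpNormEssSup (f := f e) (μ := volume.restrict (Ioo 0 (G.len e)))]
    with t ht
  rw [← eLpNorm_exponent_top] at ht
  have h2 := ht.trans (le_iSup
    (fun e => eLpNorm (f e) ∞ (volume.restrict (Ioo 0 (G.len e)))) e)
  have h3 := ENNReal.toReal_mono hfin h2
  simpa [supNorm] using h3

theorem abs_le_of_ae_edgeFun {u : G.Point → ℝ} (hu : Continuous u) {K : ℝ} {e : E}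
    (h : ∀ᵐ t ∂volume.restrict (Ioo 0 (G.len e)), |G.edgeFun u e t| ≤ K)
    (t : Icc (0 : ℝ) (G.len e)) : |u (G.onEdge e t)| ≤ K := by
  -- The almost everywhere bound becomes an almost everywhere equality of continuous functions,
  -- which then holds everywhere, end points included.
  have hae : (fun t => min |G.edgeFun u e t| K) =ᵐ[volume.restrict (Icc 0 (G.len e))]
      fun t => |G.edgeFun u e t| := by
    rw [← restrict_Ioo_eq_restrict_Icc]
    filter_upwards [h] with t ht using min_eq_left ht
  have hc := (continuous_edgeFun hu e).abs
  have := Measure.eqOn_Icc_of_ae_eq volume (G.len_pos e).ne hae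
    (hc.min continuous_const).continuousOn hc.continuousOn t.2
  simp only [edgeFun_coe] at this
  exact min_eq_left_iff.mp this

theorem Connected.abs_le_supNorm_edgeFun [Finite E] [Nonempty E] (hG : G.Connected)
    {u : G.Point → ℝ} (hu : Continuous u) (x : G.Point) : |u x| ≤ G.supNorm (G.edgeFun u) := by
  obtain ⟨e, t, rfl⟩ := hG.exists_onEdge x
  exact abs_le_of_ae_edgeFun hu (ae_abs_le_supNorm (fun e => memLp_edgeFun hu e _) e) t

section Fintype

variable [Fintype E]

theorem intPow_nonneg (p : ℝ) (f : E → ℝ → ℝ) : 0 ≤ G.intPow p f :=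
  Finset.sum_nonneg fun e _ => integral_nonneg fun t => by positivity

theorem intPow_congr {p : ℝ} {f g : E → ℝ → ℝ}
    (h : ∀ e, f e =ᵐ[volume.restrict (Ioo 0 (G.len e))] g e) : G.intPow p f = G.intPow p g :=
  Finset.sum_congr rfl fun e _ => integral_congr_ae <| (h e).mono fun t ht => by simp only [ht]

theorem intPow_const_mul (p c : ℝ) (f : E → ℝ → ℝ) :
    G.intPow p (fun e t => c * f e t) = |c| ^ p * G.intPow p f := by
  simp only [intPow, abs_mul, Real.mul_rpow (abs_nonneg _) (abs_nonneg _), integral_const_mul,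
    Finset.mul_sum]

theorem integrable_abs_rpow {p : ℝ} (hp : 0 < p) {f : ℝ → ℝ} {μ : Measure ℝ}
    (hf : MemLp f (ENNReal.ofReal p) μ) : Integrable (fun t => |f t| ^ p) μ := by
  have := hf.integrable_norm_rpow (by simpa using hp) (by simp)
  simpa [ENNReal.toReal_ofReal hp.le] using this

theorem intPow_le_of_abs_le {p : ℝ} (hp : 0 < p) {f : E → ℝ → ℝ} {K : ℝ}
    (h : ∀ e, ∀ᵐ t ∂volume.restrict (Ioo 0 (G.len e)), |f e t| ≤ K) :
    G.intPow p f ≤ K ^ p * ∑ e, G.len e := by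
  rw [Finset.mul_sum]
  refine Finset.sum_le_sum fun e _ => ?_
  calc ∫ t in Ioo 0 (G.len e), |f e t| ^ p ≤ ∫ t in Ioo 0 (G.len e), K ^ p := by
        refine integral_mono_of_nonneg (ae_of_all _ fun t => by positivity)
          (integrable_const _) ?_
        filter_upwards [h e] with t ht
        exact Real.rpow_le_rpow (abs_nonneg _) ht hp.le
    _ = K ^ p * G.len e := by simp [(G.len_pos e).le, mul_comm]

/-- A continuous function that is larger than `c` somewhere on the graph is so on a part of positive
length of an edge. -/
theorem Connected.exists_le_intPow [Nonempty E] (hG : G.Connected) {u : G.Point → ℝ}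
    (hu : Continuous u) {x : G.Point} {c : ℝ} (hc0 : 0 ≤ c) (hc : c < |u x|) :
    ∃ δ > 0, ∀ p, 0 < p → δ * c ^ p ≤ G.intPow p (G.edgeFun u) := by
  obtain ⟨e, t, rfl⟩ := hG.exists_onEdge x
  have hcont := continuous_edgeFun hu e
  set S : Set ℝ := {s | c < |G.edgeFun u e s|} with hS
  have hSo : IsOpen S := isOpen_lt continuous_const hcont.abs
  -- `t` may be an end of the edge; it still lies in the closure of the open interval.
  have hne : (S ∩ Ioo 0 (G.len e)).Nonempty := by
    have h1 : (t : ℝ) ∈ closure (Ioo 0 (G.len e)) := by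
      rw [closure_Ioo (G.len_pos e).ne]; exact t.2
    exact mem_closure_iff.mp h1 S hSo (by simpa [hS, edgeFun_coe] using hc)
  have hpos : 0 < volume (S ∩ Ioo 0 (G.len e)) := (hSo.inter isOpen_Ioo).measure_pos _ hne
  have hfin : volume (S ∩ Ioo 0 (G.len e)) ≠ ⊤ :=
    measure_ne_top_of_subset inter_subset_right measure_Ioo_lt_top.ne
  -- This `δ` is independent of `p`, so the exponential factor `c ^ p` decides the growth as `p →
  -- ∞`.
  refine ⟨volume.real (S ∩ Ioo 0 (G.len e)), ENNReal.toReal_pos hpos.ne' hfin, fun p hp => ?_⟩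
  have hint := integrable_abs_rpow hp (memLp_edgeFun hu e (ENNReal.ofReal p))
  calc volume.real (S ∩ Ioo 0 (G.len e)) * c ^ p
      = ∫ s in S ∩ Ioo 0 (G.len e), c ^ p := by simp
    _ ≤ ∫ s in S ∩ Ioo 0 (G.len e), |G.edgeFun u e s| ^ p := by
        refine setIntegral_mono_on (integrableOn_const hfin)
          (IntegrableOn.mono_set hint inter_subset_right)
          (hSo.inter isOpen_Ioo).measurableSet fun s hs => ?_
        exact Real.rpow_le_rpow hc0 (le_of_lt hs.1) hp.le
    _ ≤ ∫ s in Ioo 0 (G.len e), |G.edgeFun u e s| ^ p :=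
        setIntegral_mono_set hint (ae_of_all _ fun s => by positivity)
          (ae_of_all _ inter_subset_right)
    _ ≤ G.intPow p (G.edgeFun u) := Finset.single_le_sum
        (f := fun e => ∫ s in Ioo 0 (G.len e), |G.edgeFun u e s| ^ p)
        (fun e _ => integral_nonneg fun t => by positivity) (Finset.mem_univ e)

theorem Connected.intPow_pos [Nonempty E] (hG : G.Connected) {u : G.Point → ℝ}
    (hu : Continuous u) (hu0 : u ≠ 0) {p : ℝ} (hp : 0 < p) : 0 < G.intPow p (G.edgeFun u) := by
  obtain ⟨x, hx⟩ := Function.ne_iff.mp hu0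
  have hx' : 0 < |u x| := abs_pos.mpr hx
  obtain ⟨δ, hδ, h⟩ := hG.exists_le_intPow hu (x := x) (half_pos hx').le (half_lt_self hx')
  exact lt_of_lt_of_le (by positivity) (h p hp)

end Fintype

end MetricGraph

end

/-! ### The greatest distance and the value of `Λ_∞` -/

noncomputable section

namespace MetricGraph

variable {V E : Type*} {G : MetricGraph V E} {VD : Set V}

open Classical in
variable (G) in
/-- The distance to the ends of the edge `e`, extended by zero. -/
def tent (e : E) : G.Point → ℝ :=
  Quot.lift (Sum.elim (fun _ => 0)
    fun a => if a.1 = e then min (a.2 : ℝ) (G.len a.1 - a.2) else 0) <| by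
      rintro _ _ (e' | e')
      · simp [(G.len_pos e').le]
      · simp [(G.len_pos e').le]

open Classical in
theorem tent_onEdge (e e' : E) (t : Icc (0 : ℝ) (G.len e')) :
    G.tent e (G.onEdge e' t) = if e' = e then min (t : ℝ) (G.len e' - t) else 0 := rfl

theorem abs_tent_sub_le (e e' : E) (s t : Icc (0 : ℝ) (G.len e')) :
    |G.tent e (G.onEdge e' t) - G.tent e (G.onEdge e' s)| ≤ 1 * |(t : ℝ) - s| := by
  rw [tent_onEdge, tent_onEdge, one_mul]
  split_ifs
  · refine (abs_min_sub_min_le_max _ _ _ _).trans (max_le le_rfl ?_)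
    rw [show G.len e' - (t : ℝ) - (G.len e' - s) = -((t : ℝ) - s) by ring, abs_neg]
  · simp

/-- The maximum exists by compactness and continuity. It is positive because the tent over one edge
is 1-Lipschitz and vanishes at all vertices, so its value at the midpoint, half the edge length,
bounds the distance there from below. -/
theorem Connected.exists_isGreatest_distTo [Finite V] [Finite E] [Nonempty E]
    (hG : G.Connected) (hVD : VD.Nonempty) :
    ∃ M : ℝ, 0 < M ∧ IsGreatest (range (G.distTo VD)) M := by
  have hc : Continuous (G.distTo VD) :=
    continuous_of_lipschitz zero_le_one (hG.abs_distTo_sub_le hVD)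
  obtain ⟨e⟩ := ‹Nonempty E›
  have hl := G.len_pos e
  let m : Icc (0 : ℝ) (G.len e) := ⟨G.len e / 2, by constructor <;> linarith⟩
  have : Nonempty G.Point := ⟨G.onEdge e m⟩
  have : Nonempty E := ⟨e⟩
  obtain ⟨M, hM⟩ := (isCompact_range hc).exists_isGreatest (range_nonempty _)
  refine ⟨M, ?_, hM⟩
  have h1 := hG.abs_le_mul_distTo hVD zero_le_one (abs_tent_sub_le e) (fun v _ => rfl)
    (G.onEdge e m)
  have h2 : G.tent e (G.onEdge e m) = G.len e / 2 := by
    simp only [tent_onEdge, if_true, m]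
    rw [sub_half, min_self]
  rw [h2, one_mul, abs_of_pos (by positivity)] at h1
  have := hM.2 (mem_range_self (G.onEdge e m))
  linarith

theorem mem_competitors_of_lipschitz {u : G.Point → ℝ} {K : ℝ} (hK0 : 0 ≤ K)
    (hK : ∀ e s t, |u (G.onEdge e t) - u (G.onEdge e s)| ≤ K * |(t : ℝ) - s|)
    (h0 : ∀ v ∈ VD, u (G.vertex v) = 0) {x : G.Point} (hx : 0 < |u x|) (p : ℝ≥0∞) :
    u ∈ G.competitors p VD :=
  ⟨mem_sobolev_of_lipschitz hK0 hK p, h0, fun h => by simp [h] at hx⟩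

theorem Connected.distTo_mem_competitors [Nonempty E] (hG : G.Connected) (hVD : VD.Nonempty) {M : ℝ}
    (hM0 : 0 < M) (hM : IsGreatest (range (G.distTo VD)) M) (p : ℝ≥0∞) :
    G.distTo VD ∈ G.competitors p VD := by
  obtain ⟨x, hx⟩ := hM.1
  exact mem_competitors_of_lipschitz zero_le_one (hG.abs_distTo_sub_le hVD)
    (fun v hv => distTo_vertex hv) (x := x) (by rw [hx]; exact abs_pos.mpr hM0.ne') _

section

variable [Finite E] [Nonempty E]

/-- `‖v'‖_∞` is a Lipschitz constant of `v` along the edges, so `|v|` is at most `‖v'‖_∞` times the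
distance to `VD`, hence at most `‖v'‖_∞ * M`. -/
theorem Connected.one_div_le_supQuotient (hG : G.Connected) (hVD : VD.Nonempty) {M : ℝ}
    (hM0 : 0 < M) (hM : IsGreatest (range (G.distTo VD)) M) {v : G.Point → ℝ}
    (hv : v ∈ G.competitors ⊤ VD) : 1 / M ≤ G.supQuotient v := by
  obtain ⟨hs, h0, hne⟩ := hv
  have hK := hG.abs_le_mul_distTo hVD (supNorm_nonneg (G := G) _)
    (fun e => abs_sub_le_of_abs_edgeDeriv_le hs (ae_abs_le_supNorm (memLp_edgeDeriv hs) e)) h0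
  have h1 : G.supNorm (G.edgeFun v) ≤ G.supNorm (G.edgeDeriv v) * M := by
    refine supNorm_le (mul_nonneg (supNorm_nonneg _) hM0.le) fun e => ae_of_all _ fun t => ?_
    exact (hK _).trans (mul_le_mul_of_nonneg_left (hM.2 (mem_range_self _)) (supNorm_nonneg _))
  have h2 : 0 < G.supNorm (G.edgeFun v) := by
    obtain ⟨x, hx⟩ := Function.ne_iff.mp hne
    exact (abs_pos.mpr hx).trans_le (hG.abs_le_supNorm_edgeFun hs.1 x)
  rw [supQuotient, div_le_div_iff₀ hM0 h2]
  linarith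

theorem Connected.supQuotient_le (hG : G.Connected) {u : G.Point → ℝ} {K c : ℝ} (hK0 : 0 ≤ K)
    (hK : ∀ e s t, |u (G.onEdge e t) - u (G.onEdge e s)| ≤ K * |(t : ℝ) - s|)
    (hc : 0 < c) {x : G.Point} (hx : c ≤ |u x|) : G.supQuotient u ≤ K / c :=
  div_le_div₀ hK0 (supNorm_le hK0 (abs_edgeDeriv_le_of_lipschitz hK0 hK)) hc
    (hx.trans (hG.abs_le_supNorm_edgeFun (continuous_of_lipschitz hK0 hK) x))

/-- The distance function attains the lower bound: its Lipschitz constant is `1` and its maximum is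
`M`. -/
theorem Connected.eigenInf_eq (hG : G.Connected) (hVD : VD.Nonempty) {M : ℝ}
    (hM0 : 0 < M) (hM : IsGreatest (range (G.distTo VD)) M) : G.eigenInf VD = 1 / M := by
  obtain ⟨x, hx⟩ := hM.1
  have hx' : M ≤ |G.distTo VD x| := by rw [hx]; exact le_abs_self M
  have hd : G.distTo VD ∈ G.competitors ⊤ VD := mem_competitors_of_lipschitz zero_le_one
    (hG.abs_distTo_sub_le hVD) (fun v hv => distTo_vertex hv) (hM0.trans_le hx') _
  have hb : ∀ b ∈ G.supQuotient '' G.competitors ⊤ VD, 1 / M ≤ b := by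
    rintro _ ⟨v, hv, rfl⟩
    exact hG.one_div_le_supQuotient hVD hM0 hM hv
  refine le_antisymm ?_ (le_csInf ⟨_, mem_image_of_mem _ hd⟩ hb)
  exact (csInf_le ⟨_, hb⟩ (mem_image_of_mem _ hd)).trans
    (hG.supQuotient_le zero_le_one (hG.abs_distTo_sub_le hVD) hM0 hx')

theorem Connected.isMinimizerInf_of_lipschitz (hG : G.Connected) (hVD : VD.Nonempty)
    {u : G.Point → ℝ}
    (hK : ∀ e s t, |u (G.onEdge e t) - u (G.onEdge e s)| ≤ G.eigenInf VD * |(t : ℝ) - s|)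
    {M : ℝ} (hM0 : 0 < M) (hM : IsGreatest (range (G.distTo VD)) M)
    (h0 : ∀ v ∈ VD, u (G.vertex v) = 0) {x : G.Point} (hx : 1 ≤ |u x|) :
    G.IsMinimizerInf VD u := by
  have he := hG.eigenInf_eq hVD hM0 hM
  have hK0 : 0 ≤ G.eigenInf VD := by rw [he]; positivity
  have hu := mem_competitors_of_lipschitz hK0 hK h0 (one_pos.trans_le hx) ⊤
  refine ⟨hu, le_antisymm ?_ ?_⟩
  · simpa using hG.supQuotient_le hK0 hK one_pos hx
  · rw [he]
    exact hG.one_div_le_supQuotient hVD hM0 hM hu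

end

end MetricGraph

end

/-! ### Comparison of exponents, limits as `p → ∞`, and the upper bound for `λ_p` -/

noncomputable section

/-- After scaling to `K = 1`: the power `r` of a number below one is at most `1`, and that of a
number above one is at most its power `p`. The freedom in `K` is essential: if `∫|f|^p ≤ k ^ p` with
`k < K`, the second term contributes at most `(k / K) ^ p`, which tends to zero. -/
theorem Real.rpow_le_mul_one_add_div_rpow {a K r p : ℝ} (ha : 0 ≤ a) (hK : 0 < K) (hr : 0 ≤ r)
    (hrp : r ≤ p) : a ^ r ≤ K ^ r * (1 + a ^ p / K ^ p) := by
  rw [← Real.div_rpow ha hK.le]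
  have h0 : 0 ≤ a / K := by positivity
  have h1 : a ^ r = K ^ r * (a / K) ^ r := by
    rw [← Real.mul_rpow hK.le h0, mul_div_cancel₀ _ hK.ne']
  rw [h1]
  refine mul_le_mul_of_nonneg_left ?_ (by positivity)
  rcases le_total (a / K) 1 with h | h
  · have := Real.rpow_le_one h0 h hr
    have : 0 ≤ (a / K) ^ p := by positivity
    linarith
  · have := Real.rpow_le_rpow_of_exponent_le h hrp
    linarith

namespace MetricGraph

variable {V E : Type*} {G : MetricGraph V E} {VD : Set V} [Fintype E]

/-- Bounds on a power of a function from bounds on a higher power. -/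
theorem intPow_le_mul_add {f : E → ℝ → ℝ} {K r p : ℝ} (hK : 0 < K) (hr : 0 < r) (hrp : r ≤ p)
    (hf : ∀ e, MemLp (f e) (ENNReal.ofReal p) (volume.restrict (Ioo 0 (G.len e)))) :
    G.intPow r f ≤ K ^ r * (∑ e, G.len e + G.intPow p f / K ^ p) := by
  simp only [intPow]
  rw [Finset.sum_div, ← Finset.sum_add_distrib, Finset.mul_sum]
  refine Finset.sum_le_sum fun e _ => ?_
  have hi := integrable_abs_rpow (hr.trans_le hrp) (hf e)
  calc ∫ t in Ioo 0 (G.len e), |f e t| ^ r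
      ≤ ∫ t in Ioo 0 (G.len e), K ^ r * (1 + |f e t| ^ p / K ^ p) := by
        refine integral_mono_of_nonneg (ae_of_all _ fun t => by positivity)
          (((integrable_const 1).add (hi.div_const _)).const_mul _) (ae_of_all _ fun t => ?_)
        exact Real.rpow_le_mul_one_add_div_rpow (abs_nonneg _) hK hr.le hrp
    _ = _ := by
        rw [integral_const_mul, integral_add (integrable_const 1) (hi.div_const _),
          integral_div]
        simp [(G.len_pos e).le]

/-- The pointwise bound with `r = 1`, integrated over the segment. The error term is small in two
regimes: `p` large with `K` above the size of `‖u'‖_p`, which yields Lipschitz limits, and `p = 2`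
with `K` large, which yields equicontinuity. -/
theorem abs_sub_le_mul_add {u : G.Point → ℝ} {p K : ℝ} (hp : 1 ≤ p)
    (hu : u ∈ G.sobolev (ENNReal.ofReal p)) (hK : 0 < K) (e : E) (s t : Icc (0 : ℝ) (G.len e)) :
    |u (G.onEdge e t) - u (G.onEdge e s)| ≤
      K * |(t : ℝ) - s| + K * (G.intPow p (G.edgeDeriv u) / K ^ p) := by
  rw [sub_eq_integral_edgeDeriv hu]
  have hsub : uIoc (s : ℝ) t ⊆ Ioc 0 (G.len e) := fun x hx =>
    ⟨(le_min s.2.1 t.2.1).trans_lt hx.1, hx.2.trans (max_le s.2.2 t.2.2)⟩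
  have hi := integrable_abs_rpow (by linarith) (memLp_edgeDeriv hu e)
  have hi' : IntegrableOn (fun x => |G.edgeDeriv u e x| ^ p) (Ioc 0 (G.len e)) := by
    rwa [IntegrableOn, ← restrict_Ioo_eq_restrict_Ioc]
  have hi2 := hi'.mono_set hsub
  have hfin : IntegrableOn (fun _ => (1 : ℝ)) (uIoc (s : ℝ) t) := by
    simp [integrableOn_const_iff, uIoc]
  calc |∫ x in (s : ℝ)..t, G.edgeDeriv u e x|
      ≤ ∫ x in uIoc (s : ℝ) t, |G.edgeDeriv u e x| :=
        by simpa only [Real.norm_eq_abs] using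
          intervalIntegral.norm_integral_le_integral_norm_uIoc (f := G.edgeDeriv u e)
    _ ≤ ∫ x in uIoc (s : ℝ) t, K * (1 + |G.edgeDeriv u e x| ^ p / K ^ p) := by
        refine integral_mono_of_nonneg (ae_of_all _ fun t => by positivity)
          ((hfin.add (hi2.div_const _)).const_mul _) (ae_of_all _ fun x => ?_)
        simpa using Real.rpow_le_mul_one_add_div_rpow (abs_nonneg (G.edgeDeriv u e x)) hK
          zero_le_one hp
    _ = K * |(t : ℝ) - s| + K * ((∫ x in uIoc (s : ℝ) t, |G.edgeDeriv u e x| ^ p) / K ^ p) := by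
        rw [integral_const_mul, integral_add hfin (hi2.div_const _), integral_div, mul_add]
        congr 2
        simp [uIoc, measureReal_def, max_sub_min_eq_abs']
        rw [abs_sub_comm]
    _ ≤ _ := by
        gcongr
        calc ∫ x in uIoc (s : ℝ) t, |G.edgeDeriv u e x| ^ p
            ≤ ∫ x in Ioc 0 (G.len e), |G.edgeDeriv u e x| ^ p :=
              setIntegral_mono_set hi' (ae_of_all _ fun s => by positivity)
                (ae_of_all _ hsub)
          _ = ∫ x in Ioo 0 (G.len e), |G.edgeDeriv u e x| ^ p := by
              rw [restrict_Ioo_eq_restrict_Ioc]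
          _ ≤ G.intPow p (G.edgeDeriv u) := Finset.single_le_sum
              (f := fun e => ∫ s in Ioo 0 (G.len e), |G.edgeDeriv u e s| ^ p)
              (fun e _ => integral_nonneg fun t => by positivity) (Finset.mem_univ e)

/-- Limits of functions with `‖u_j'‖_{p_j}` asymptotically at most `K`, where `p_j → ∞`, are
`K`-Lipschitz along the edges. -/
theorem abs_sub_le_of_tendsto {p : ℕ → ℝ} {us : ℕ → G.Point → ℝ} {u : G.Point → ℝ} {K : ℝ}
    (hp : Tendsto p atTop atTop) (hK0 : 0 ≤ K)
    (hus : ∀ᶠ j in atTop, us j ∈ G.sobolev (ENNReal.ofReal (p j)))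
    (hb : ∀ k > K, ∀ᶠ j in atTop, G.intPow (p j) (G.edgeDeriv (us j)) ≤ k ^ p j)
    (hlim : ∀ x, Tendsto (fun j => us j x) atTop (𝓝 (u x)))
    (e : E) (s t : Icc (0 : ℝ) (G.len e)) :
    |u (G.onEdge e t) - u (G.onEdge e s)| ≤ K * |(t : ℝ) - s| := by
  have hl := ((hlim (G.onEdge e t)).sub (hlim (G.onEdge e s))).abs
  have key : ∀ k > K, |u (G.onEdge e t) - u (G.onEdge e s)| ≤ k * |(t : ℝ) - s| := by
    intro k hk
    -- With `∫|u_j'|^{p_j} ≤ k' ^ p_j` and `k' < k`, the error term is at most `k * (k' / k) ^ p_j`,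
    -- which tends to zero. Letting `k` decrease to `K` finishes the proof.
    obtain ⟨k', h1, h2⟩ := exists_between hk
    have hk' : 0 < k' := hK0.trans_lt h1
    have hk0 : 0 < k := hk'.trans h2
    have hpow : Tendsto (fun j => (k' / k) ^ p j) atTop (𝓝 0) :=
      (tendsto_rpow_atTop_of_base_lt_one (k' / k) (by have : 0 < k' / k := by positivity
                                                      linarith)
        ((div_lt_one hk0).mpr h2)).comp hp
    have hr : Tendsto (fun j => k * |(t : ℝ) - s| + k * (k' / k) ^ p j) atTop
        (𝓝 (k * |(t : ℝ) - s|)) := by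
      simpa using (hpow.const_mul k).const_add (k * |(t : ℝ) - s|)
    refine le_of_tendsto_of_tendsto hl hr ?_
    filter_upwards [hus, hb k' h1, hp.eventually_ge_atTop 1] with j hj hbj hpj
    refine (abs_sub_le_mul_add hpj hj hk0 e s t).trans ?_
    rw [Real.div_rpow hk'.le hk0.le]
    gcongr
  have hc : Continuous fun k : ℝ => k * |(t : ℝ) - s| := by fun_prop
  refine ge_of_tendsto (hc.continuousWithinAt (s := Ioi K) (x := K)).tendsto ?_
  filter_upwards [self_mem_nhdsWithin] with k hk using key k hk

/-- Uniform limits of functions with `‖u_j‖_{p_j} = 1`, where `p_j → ∞`, reach the value `1`. -/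
theorem exists_one_le_abs_of_tendstoUniformly [Finite V] [Nonempty E] {p : ℕ → ℝ}
    {us : ℕ → G.Point → ℝ} {u : G.Point → ℝ} (hp : Tendsto p atTop atTop) (hu : Continuous u)
    (h1 : ∀ᶠ j in atTop, G.intPow (p j) (G.edgeFun (us j)) = 1)
    (hlim : TendstoUniformly us u atTop) : ∃ x, 1 ≤ |u x| := by
  obtain ⟨e⟩ := ‹Nonempty E›
  have : Nonempty G.Point := ⟨G.vertex (G.src e)⟩
  obtain ⟨_, ⟨x, rfl⟩, hx⟩ := (isCompact_range hu.abs).exists_isGreatest (range_nonempty _)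
  refine ⟨x, not_lt.mp fun hlt => ?_⟩
  -- If `max |u| < a < 1`, then `|u_j| ≤ a` for large `j`, so `∫|u_j|^{p_j}` is at most `a ^ p_j`
  -- times the total length. This tends to zero, against the normalization.
  obtain ⟨a, ha, ha1⟩ := exists_between hlt
  have ha0 : 0 < a := (abs_nonneg _).trans_lt ha
  have hpow : Tendsto (fun j => a ^ p j * ∑ e, G.len e) atTop (𝓝 0) := by
    simpa using ((tendsto_rpow_atTop_of_base_lt_one a (by linarith) ha1).comp hp).mul_const
      (∑ e, G.len e)
  obtain ⟨j, hj1, hj2, hj3, hj4⟩ := (h1.and ((hpow.eventually_lt_const one_pos).and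
    ((hp.eventually_gt_atTop 0).and (Metric.tendstoUniformly_iff.mp hlim (a - |u x|)
      (sub_pos.mpr ha))))).exists
  have := intPow_le_of_abs_le (G := G) (K := a) hj3 (f := G.edgeFun (us j)) fun e =>
    ae_of_all _ fun t => by
      have h2 := hj4 (G.onEdge e (projIcc 0 (G.len e) (G.len_pos e).le t))
      have h3 := hx (mem_range_self (G.onEdge e (projIcc 0 (G.len e) (G.len_pos e).le t)))
      rw [Real.dist_eq, abs_sub_comm] at h2
      have h4 := abs_sub_abs_le_abs_sub (us j (G.onEdge e (projIcc 0 (G.len e) (G.len_pos e).le t)))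
        (u (G.onEdge e (projIcc 0 (G.len e) (G.len_pos e).le t)))
      simp only at h3
      rw [edgeFun]
      linarith
  linarith

theorem firstEigenvalue_nonneg (p : ℝ) (VD : Set V) : 0 ≤ G.firstEigenvalue p VD := by
  refine Real.sInf_nonneg ?_
  rintro _ ⟨u, _, rfl⟩
  exact div_nonneg (intPow_nonneg _ _) (intPow_nonneg _ _)

theorem firstEigenvalue_le {p : ℝ} {u : G.Point → ℝ}
    (hu : u ∈ G.competitors (ENNReal.ofReal p) VD) :
    G.firstEigenvalue p VD ≤ G.rayleigh p u := by
  refine csInf_le ⟨0, ?_⟩ (mem_image_of_mem _ hu)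
  rintro _ ⟨u, _, rfl⟩
  exact div_nonneg (intPow_nonneg _ _) (intPow_nonneg _ _)

variable [Nonempty E]

/-- Test with the distance function: the numerator is at most the total length, and the denominator
is at least `δ * a ^ p` for any `a < M`. Choosing `a > 1 / k` gives `k * a > 1`, so `(k * a) ^ p`
eventually exceeds the total length divided by `δ`. -/
theorem Connected.eventually_firstEigenvalue_le (hG : G.Connected) (hVD : VD.Nonempty) {M : ℝ}
    (hM0 : 0 < M) (hM : IsGreatest (range (G.distTo VD)) M) {k : ℝ} (hk : 1 / M < k) :
    ∀ᶠ p in atTop, G.firstEigenvalue p VD ≤ k ^ p := by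
  have hd := hG.distTo_mem_competitors hVD hM0 hM
  obtain ⟨x, hx⟩ := hM.1
  have hk0 : 0 < k := (one_div_pos.mpr hM0).trans hk
  obtain ⟨a, ha1, ha2⟩ := exists_between (show 1 / k < M by
    rwa [one_div_lt hk0 hM0])
  have ha0 : 0 < a := (one_div_pos.mpr hk0).trans ha1
  have hka : 1 < k * a := by rwa [div_lt_iff₀' hk0] at ha1
  obtain ⟨δ, hδ, hint⟩ := hG.exists_le_intPow (hd ⊤).1.1 (x := x) ha0.le
    (by rw [hx, abs_of_pos hM0]; exact ha2)
  have hpow : Tendsto (fun p : ℝ => (k * a) ^ p) atTop atTop :=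
    tendsto_rpow_atTop_of_base_gt_one _ hka
  filter_upwards [eventually_gt_atTop 0, hpow.eventually_ge_atTop ((∑ e, G.len e) / δ)]
    with p hp hpT
  refine (firstEigenvalue_le (hd _)).trans ?_
  have h1 := intPow_le_of_abs_le hp
    (abs_edgeDeriv_le_of_lipschitz zero_le_one (hG.abs_distTo_sub_le hVD))
  have h2 := hint p hp
  rw [Real.one_rpow, one_mul] at h1
  rw [rayleigh, div_le_iff₀ (lt_of_lt_of_le (by positivity) h2)]
  calc G.intPow p (G.edgeDeriv (G.distTo VD)) ≤ ∑ e, G.len e := h1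
    _ ≤ (k * a) ^ p * δ := by rwa [div_le_iff₀ hδ] at hpT
    _ = k ^ p * (δ * a ^ p) := by rw [Real.mul_rpow hk0.le ha0.le]; ring
    _ ≤ _ := by gcongr

end MetricGraph

end

/-! ### Compactness and the limit of `λ_p ^ (1 / p)` -/

noncomputable section

namespace MetricGraph

variable {V E : Type*} {G : MetricGraph V E} {VD : Set V}

theorem equicontinuous_of_forall_abs_sub_le {ι : Type*} {F : ι → G.Point → ℝ} {B : ℝ}
    (hB0 : 0 ≤ B) (hB : ∀ i e s t, ∀ k > 0,
      |F i (G.onEdge e t) - F i (G.onEdge e s)| ≤ k * |(t : ℝ) - s| + B / k) :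
    Equicontinuous F := by
  -- Equicontinuity is continuity of a single map into a function space, so it too can be checked
  -- along the edges.
  rw [equicontinuous_iff_continuous]
  refine continuous_of_forall_onEdge fun e => ?_
  have : Equicontinuous fun i t => F i (G.onEdge e t) := by
    intro s
    rw [Metric.equicontinuousAt_iff]
    intro ε hε
    -- This makes `B / k ≤ ε / 2`; the `1` covers `B = 0`. The radius `ε / (2 * k)` then handles the
    -- other term.
    set k : ℝ := 2 * (B + 1) / ε with hk
    have hk0 : 0 < k := by positivity
    refine ⟨ε / (2 * k), by positivity, fun t ht i => ?_⟩
    rw [dist_comm, Real.dist_eq]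
    have h1 := hB i e s t k hk0
    have h2 : |(t : ℝ) - s| < ε / (2 * k) := ht
    have h3 : k * |(t : ℝ) - s| < ε / 2 := by
      calc k * |(t : ℝ) - s| < k * (ε / (2 * k)) := by gcongr
        _ = ε / 2 := by field_simp
    have h4 : B / k ≤ ε / 2 := by
      rw [hk, div_le_iff₀ (by positivity)]
      have : ε / 2 * (2 * (B + 1) / ε) = B + 1 := by field_simp
      linarith
    linarith
  exact equicontinuous_iff_continuous.mp this

/-- The error `B` is paid once per segment, so the bound depends on the number of segments and not
just on the length. A constant is therefore attached to each path, uniformly in `h`. -/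
theorem PathLength.exists_abs_sub_le {x y : G.Point} {r : ℝ} (hp : G.PathLength x y r) (B : ℝ) :
    ∃ C, ∀ h : G.Point → ℝ,
      (∀ e s t, |h (G.onEdge e t) - h (G.onEdge e s)| ≤ |(t : ℝ) - s| + B) → |h y - h x| ≤ C := by
  induction hp with
  | refl => exact ⟨0, fun h _ => by simp⟩
  | step e s t r _ ih =>
    obtain ⟨C, hC⟩ := ih
    refine ⟨|(t : ℝ) - s| + B + C, fun h hh => ?_⟩
    exact (_root_.abs_sub_le _ (h (G.onEdge e s)) _).trans (add_le_add (hh e s t) (hC h hh))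

/-- One fixed path from a vertex of `VD` to the start of each edge, followed by one segment in that
edge, reaches every point. Finitely many edges give a common constant. -/
theorem Connected.exists_forall_abs_le [Finite E] [Nonempty E] (hG : G.Connected)
    (hVD : VD.Nonempty) (B : ℝ) :
    ∃ C, ∀ h : G.Point → ℝ,
      (∀ e s t, |h (G.onEdge e t) - h (G.onEdge e s)| ≤ |(t : ℝ) - s| + B) →
      (∀ v ∈ VD, h (G.vertex v) = 0) → ∀ x, |h x| ≤ C := by
  obtain ⟨v, hv⟩ := hVD
  choose r hr using fun e => hG.exists_pathLength (G.vertex v)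
    (G.onEdge e ⟨0, le_rfl, (G.len_pos e).le⟩)
  choose C hC using fun e => (hr e).exists_abs_sub_le B
  obtain ⟨C', hC'⟩ := (finite_range fun e => C e + (G.len e + B)).bddAbove
  refine ⟨C', fun h hh h0 x => ?_⟩
  obtain ⟨e, t, rfl⟩ := hG.exists_onEdge x
  refine le_trans ?_ (hC' (mem_range_self e))
  have h1 := hC e h hh
  have h2 := hh e ⟨0, le_rfl, (G.len_pos e).le⟩ t
  rw [h0 v hv, sub_zero] at h1
  rw [sub_zero, abs_of_nonneg t.2.1] at h2
  have h3 := abs_sub_abs_le_abs_sub (h (G.onEdge e t))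
    (h (G.onEdge e ⟨0, le_rfl, (G.len_pos e).le⟩))
  have h4 := t.2.2
  linarith

variable [Fintype E]

theorem exists_normalized {p : ℝ} (hp : 0 < p) {v : G.Point → ℝ}
    (hv : v ∈ G.competitors (ENNReal.ofReal p) VD) (hpos : 0 < G.intPow p (G.edgeFun v)) :
    ∃ w ∈ G.competitors (ENNReal.ofReal p) VD, G.intPow p (G.edgeFun w) = 1 ∧
      G.intPow p (G.edgeDeriv w) = G.rayleigh p v := by
  set c : ℝ := (G.intPow p (G.edgeFun v)) ^ (-(1 / p))
  have hc : 0 < c := Real.rpow_pos_of_pos hpos _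
  have hcp : |c| ^ p = (G.intPow p (G.edgeFun v))⁻¹ := by
    rw [abs_of_pos hc, ← Real.rpow_mul hpos.le, ← Real.rpow_neg_one]
    congr 1
    field_simp
  refine ⟨c • v, ⟨Submodule.smul_mem _ _ hv.1, fun x hx => by simp [hv.2.1 x hx],
    smul_ne_zero hc.ne' hv.2.2⟩, ?_, ?_⟩
  · change G.intPow p (fun e t => c * G.edgeFun v e t) = 1
    rw [intPow_const_mul, hcp, inv_mul_cancel₀ hpos.ne']
  · rw [intPow_congr (edgeDeriv_smul_ae hv.1 c), intPow_const_mul, hcp, rayleigh, div_eq_inv_mul]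

variable [Nonempty E]

/-- Compactness of sequences with `‖u_j'‖_{p_j}` bounded. -/
theorem Connected.exists_subseq_tendstoUniformly [Finite V] (hG : G.Connected)
    (hVD : VD.Nonempty) {p : ℕ → ℝ} {us : ℕ → G.Point → ℝ} {K : ℝ}
    (hp : ∀ j, 2 ≤ p j) (hK : 0 < K)
    (hus : ∀ j, us j ∈ G.sobolev (ENNReal.ofReal (p j)))
    (h0 : ∀ j, ∀ v ∈ VD, us j (G.vertex v) = 0)
    (hb : ∀ j, G.intPow (p j) (G.edgeDeriv (us j)) ≤ K ^ p j) :
    ∃ (φ : ℕ → ℕ) (u : G.Point → ℝ), StrictMono φ ∧ Continuous u ∧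
      TendstoUniformly (fun j => us (φ j)) u atTop := by
  -- Since `p j ≥ 2`, the bounds on `‖u_j'‖_{p_j}` descend to a bound `B` on `∫|u_j'|^2` independent
  -- of `j`.
  set B : ℝ := K ^ (2 : ℝ) * (∑ e, G.len e + 1)
  have hT : 0 ≤ ∑ e, G.len e := Finset.sum_nonneg fun e _ => (G.len_pos e).le
  have hB0 : 0 ≤ B := by positivity
  have hmod : ∀ j e s t, ∀ k > 0,
      |us j (G.onEdge e t) - us j (G.onEdge e s)| ≤ k * |(t : ℝ) - s| + B / k := by
    intro j e s t k hk
    have h1 : G.intPow 2 (G.edgeDeriv (us j)) ≤ B := by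
      refine (intPow_le_mul_add hK two_pos (hp j) (memLp_edgeDeriv (hus j))).trans ?_
      have : G.intPow (p j) (G.edgeDeriv (us j)) / K ^ p j ≤ 1 :=
        div_le_one_of_le₀ (hb j) (by positivity)
      simp only [B]
      gcongr
    have h2 := abs_sub_le_mul_add one_le_two
      (sobolev_mono (ENNReal.ofReal_le_ofReal (hp j)) (hus j)) hk e s t
    refine h2.trans ?_
    have h3 : k * (G.intPow 2 (G.edgeDeriv (us j)) / k ^ (2 : ℝ))
        = G.intPow 2 (G.edgeDeriv (us j)) / k := by
      rw [Real.rpow_two]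
      field_simp
    rw [h3]
    gcongr
  obtain ⟨C, hC⟩ := hG.exists_forall_abs_le hVD B
  have hbd : ∀ j x, |us j x| ≤ C := fun j => hC (us j)
    (fun e s t => by simpa using hmod j e s t 1 one_pos) (h0 j)
  let F : ℕ → BoundedContinuousFunction G.Point ℝ := fun j =>
    BoundedContinuousFunction.mkOfCompact ⟨us j, (hus j).1⟩
  have hcomp : IsCompact (closure (range F)) := by
    refine BoundedContinuousFunction.arzela_ascoli (Icc (-C) C) isCompact_Icc _ ?_ ?_
    · rintro _ x ⟨j, rfl⟩
      exact abs_le.mp (hbd j x)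
    · refine equicontinuous_of_forall_abs_sub_le hB0 ?_
      rintro ⟨_, j, rfl⟩ e s t k hk
      exact hmod j e s t k hk
  obtain ⟨u, _, φ, hφ, hlim⟩ := hcomp.tendsto_subseq fun j => subset_closure (mem_range_self j)
  exact ⟨φ, u, hφ, u.continuous, BoundedContinuousFunction.tendsto_iff_tendstoUniformly.mp hlim⟩

/-- Otherwise normalized competitors with `∫|w'|^p ≤ k ^ p` exist for exponents tending to infinity.
A uniform limit is `k`-Lipschitz along the edges, vanishes on `VD` and reaches size `1`, yet is
bounded by `k * M < 1`. Using competitors instead of minimizers avoids any existence question. -/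
theorem Connected.eventually_le_firstEigenvalue [Finite V] (hG : G.Connected)
    (hVD : VD.Nonempty) {M : ℝ} (hM0 : 0 < M) (hM : IsGreatest (range (G.distTo VD)) M)
    {k : ℝ} (hk0 : 0 < k) (hk : k < 1 / M) :
    ∀ᶠ p in atTop, k ^ p ≤ G.firstEigenvalue p VD := by
  by_contra hcon
  rw [not_eventually] at hcon
  obtain ⟨p, hp, hpj⟩ := exists_seq_forall_of_frequently
    (hcon.and_eventually (eventually_ge_atTop 2))
  have hw : ∀ j, ∃ w ∈ G.competitors (ENNReal.ofReal (p j)) VD,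
      G.intPow (p j) (G.edgeFun w) = 1 ∧ G.intPow (p j) (G.edgeDeriv w) ≤ k ^ p j := by
    intro j
    obtain ⟨h1, h2⟩ := hpj j
    obtain ⟨_, ⟨v, hv, rfl⟩, hlt⟩ := exists_lt_of_csInf_lt
      (Set.Nonempty.image _ ⟨_, hG.distTo_mem_competitors hVD hM0 hM _⟩) (not_le.mp h1)
    have hp0 : 0 < p j := by linarith
    obtain ⟨w, hw, hw1, hw2⟩ := exists_normalized hp0 hv (hG.intPow_pos hv.1.1 hv.2.2 hp0)
    exact ⟨w, hw, hw1, hw2 ▸ hlt.le⟩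
  choose w hw hw1 hw2 using hw
  obtain ⟨φ, u, hφ, hu, hlim⟩ := hG.exists_subseq_tendstoUniformly hVD (fun j => (hpj j).2) hk0
    (fun j => (hw j).1) (fun j => (hw j).2.1) hw2
  have hpφ := hp.comp hφ.tendsto_atTop
  obtain ⟨x, hx⟩ := exists_one_le_abs_of_tendstoUniformly hpφ hu
    (Eventually.of_forall fun j => hw1 (φ j)) hlim
  have hlip := abs_sub_le_of_tendsto hpφ hk0.le (Eventually.of_forall fun j => (hw (φ j)).1)
    (fun k' hk' => Eventually.of_forall fun j => (hw2 (φ j)).trans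
      (Real.rpow_le_rpow hk0.le hk'.le (by linarith [(hpj (φ j)).2])))
    (fun x => hlim.tendsto_at x)
  have hz : ∀ v ∈ VD, u (G.vertex v) = 0 := fun v hv =>
    tendsto_nhds_unique (hlim.tendsto_at _)
      (tendsto_const_nhds.congr fun j => ((hw (φ j)).2.1 v hv).symm)
  have h1 := hG.abs_le_mul_distTo hVD hk0.le hlip hz x
  have h2 := mul_le_mul_of_nonneg_left (hM.2 (mem_range_self x)) hk0.le
  rw [lt_div_iff₀ hM0] at hk
  linarith

theorem Connected.tendsto_firstEigenvalue_rpow [Finite V] (hG : G.Connected)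
    (hVD : VD.Nonempty) {M : ℝ} (hM0 : 0 < M) (hM : IsGreatest (range (G.distTo VD)) M) :
    Tendsto (fun p : ℝ => G.firstEigenvalue p VD ^ (1 / p)) atTop (𝓝 (1 / M)) := by
  have hM' : 0 < 1 / M := one_div_pos.mpr hM0
  rw [tendsto_order]
  constructor
  · intro a ha
    -- `a` may be negative; the maximum with `0` keeps the base `k` positive.
    obtain ⟨k, hk1, hk2⟩ := exists_between (max_lt ha hM')
    have hk0 : 0 < k := (le_max_right _ _).trans_lt hk1
    filter_upwards [hG.eventually_le_firstEigenvalue hVD hM0 hM hk0 hk2, eventually_gt_atTop 0]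
      with p h1 hp
    refine ((le_max_left _ _).trans_lt hk1).trans_le ?_
    have := Real.rpow_le_rpow (by positivity) h1 (one_div_pos.mpr hp).le
    rwa [← Real.rpow_mul hk0.le, mul_one_div_cancel hp.ne', Real.rpow_one] at this
  · intro b hb
    obtain ⟨k, hk1, hk2⟩ := exists_between hb
    have hk0 : 0 < k := hM'.trans hk1
    filter_upwards [hG.eventually_firstEigenvalue_le hVD hM0 hM hk1, eventually_gt_atTop 0]
      with p h1 hp
    refine lt_of_le_of_lt ?_ hk2
    have := Real.rpow_le_rpow (firstEigenvalue_nonneg _ _) h1 (one_div_pos.mpr hp).le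
    rwa [← Real.rpow_mul hk0.le, mul_one_div_cancel hp.ne', Real.rpow_one] at this

end MetricGraph

end

/-! ### Clarkson's inequality, convex combinations, and closedness of the weak derivative -/

noncomputable section

/-- Clarkson's inequality for real numbers. -/
theorem Real.clarkson {q : ℝ} (hq : 2 ≤ q) (a b : ℝ) :
    |1 / 2 * (a + b)| ^ q + |1 / 2 * (a - b)| ^ q ≤ (|a| ^ q + |b| ^ q) / 2 := by
  -- With `|z| ^ q = (z ^ 2) ^ (q / 2)`, the claim follows from superadditivity of the power `q / 2
  -- ≥ 1`, the parallelogram law, and convexity of that power.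
  have e : ∀ z : ℝ, |z| ^ q = (z ^ 2) ^ (q / 2) := fun z => by
    rw [← sq_abs, ← Real.rpow_natCast, ← Real.rpow_mul (abs_nonneg _)]
    congr 1
    push_cast
    ring
  have hq2 : 1 ≤ q / 2 := by linarith
  simp only [e]
  calc ((1 / 2 * (a + b)) ^ 2) ^ (q / 2) + ((1 / 2 * (a - b)) ^ 2) ^ (q / 2)
      ≤ ((1 / 2 * (a + b)) ^ 2 + (1 / 2 * (a - b)) ^ 2) ^ (q / 2) :=
        Real.add_rpow_le_rpow_add (by positivity) (by positivity) hq2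
    _ = ((1 / 2 : ℝ) • a ^ 2 + (1 / 2 : ℝ) • b ^ 2) ^ (q / 2) := by
        congr 1
        simp only [smul_eq_mul]
        ring
    _ ≤ (1 / 2 : ℝ) • (a ^ 2) ^ (q / 2) + (1 / 2 : ℝ) • (b ^ 2) ^ (q / 2) :=
        (convexOn_rpow hq2).2 (sq_nonneg a) (sq_nonneg b) (by norm_num) (by norm_num)
          (by norm_num)
    _ = _ := by simp only [smul_eq_mul]; ring

/-- A Mazur type lemma: for a functional satisfying Clarkson's inequality, the tails of a bounded
sequence have convex combinations that form a Cauchy sequence. -/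
theorem exists_convexHull_cauchy {W : Type*} [AddCommGroup W] [Module ℝ W] {Q : W → ℝ}
    (hQ0 : ∀ a, 0 ≤ Q a)
    (hQ : ∀ a b, Q ((1 / 2 : ℝ) • (a + b)) + Q ((1 / 2 : ℝ) • (a - b)) ≤ (Q a + Q b) / 2)
    {w : ℕ → W} {C : ℝ} (hC : ∀ j, Q (w j) ≤ C) :
    ∃ y : ℕ → W, (∀ n, y n ∈ convexHull ℝ (w '' Ici n)) ∧
      ∀ ε > 0, ∃ N, ∀ n ≥ N, ∀ k ≥ N, Q ((1 / 2 : ℝ) • (y n - y k)) < ε := by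
  set S : ℕ → Set W := fun n => convexHull ℝ (w '' Ici n)
  -- The infima of `Q` over the hulls of the tails increase and are bounded by `C`, so they
  -- converge. The `y n` are chosen as almost minimizers.
  set m : ℕ → ℝ := fun n => sInf (Q '' S n)
  have hS : Antitone S := fun n k h => convexHull_mono (image_mono (Ici_subset_Ici.mpr h))
  have hwS : ∀ n, w n ∈ S n := fun n => subset_convexHull ℝ _ (mem_image_of_mem _ self_mem_Ici)
  have hbdd : ∀ n, BddBelow (Q '' S n) := fun n => ⟨0, by
    rintro _ ⟨a, _, rfl⟩
    exact hQ0 a⟩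
  have hmono : Monotone m := fun n k h =>
    csInf_le_csInf (hbdd n) ⟨_, mem_image_of_mem _ (hwS k)⟩ (image_mono (hS h))
  have hmC : BddAbove (range m) := ⟨C, by
    rintro _ ⟨n, rfl⟩
    exact (csInf_le (hbdd n) (mem_image_of_mem _ (hwS n))).trans (hC n)⟩
  have hex : ∀ n : ℕ, ∃ y ∈ S n, Q y < m n + 1 / (n + 1) := by
    intro n
    obtain ⟨_, ⟨y, hy, rfl⟩, h⟩ := exists_lt_of_csInf_lt (s := Q '' S n)
      ⟨_, mem_image_of_mem _ (hwS n)⟩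
      (lt_add_of_pos_right (m n) (show (0 : ℝ) < 1 / (n + 1) by positivity))
    exact ⟨y, hy, h⟩
  choose y hy hQy using hex
  refine ⟨y, hy, fun ε hε => ?_⟩
  have hlim := tendsto_atTop_ciSup hmono hmC
  obtain ⟨N, hN1, hN2⟩ := ((hlim.eventually_const_lt (sub_lt_self _ (half_pos hε))).and
    ((tendsto_one_div_add_atTop_nhds_zero_nat (𝕜 := ℝ)).eventually_lt_const (half_pos hε))).exists
  have hb : ∀ n ≥ N, Q (y n) < (⨆ n, m n) + ε / 2 := fun n hn => by
    have h1 := le_ciSup hmC n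
    have h2 : 1 / ((n : ℝ) + 1) ≤ 1 / (N + 1) := by gcongr
    linarith [hQy n]
  refine ⟨N, fun n hn k hk => ?_⟩
  -- The midpoint stays in the hull of the `N`-th tail, so `Q` there is at least `m N`, within `ε /
  -- 2` of the supremum. As both `Q (y n)` and `Q (y k)` lie below the supremum plus `ε / 2`,
  -- Clarkson leaves less than `ε` for the half difference.
  have hmid : (1 / 2 : ℝ) • (y n + y k) ∈ S N := by
    rw [smul_add]
    exact convex_convexHull ℝ _ (hS hn (hy n)) (hS hk (hy k)) (by norm_num) (by norm_num)
      (by norm_num)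
  have h1 : m N ≤ _ := csInf_le (hbdd N) (mem_image_of_mem Q hmid)
  have h2 := hQ (y n) (y k)
  linarith [hb n hn, hb k hk]

theorem norm_toLp_rpow {μ : Measure ℝ} {q : ℝ} (hq : 1 ≤ q) {f : ℝ → ℝ}
    (hf : MemLp f (ENNReal.ofReal q) μ) : ‖hf.toLp f‖ ^ q = ∫ t, |f t| ^ q ∂μ := by
  have hq0 : 0 < q := by linarith
  have h0 : 0 ≤ ∫ t, |f t| ^ q ∂μ := integral_nonneg fun t => by positivity
  rw [Lp.norm_toLp, hf.eLpNorm_eq_integral_rpow_norm (by simpa using hq0) (by simp),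
    ENNReal.toReal_ofReal hq0.le]
  simp only [Real.norm_eq_abs]
  rw [ENNReal.toReal_ofReal (by positivity), ← Real.rpow_mul h0, inv_mul_cancel₀ hq0.ne',
    Real.rpow_one]

/-- The weak derivative is a closed operator in `L^q`. -/
theorem exists_isWeakDeriv_of_cauchy {L q : ℝ} (hL : 0 < L) (hq : 1 ≤ q) {f : ℝ → ℝ}
    {fs gs : ℕ → ℝ → ℝ} (hfs : ∀ n, ContinuousOn (fs n) (Icc 0 L))
    (hw : ∀ n, IsWeakDeriv L (fs n) (gs n))
    (hgs : ∀ n, MemLp (gs n) (ENNReal.ofReal q) (volume.restrict (Ioo 0 L)))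
    (hcau : ∀ ε > 0, ∃ N, ∀ n ≥ N, ∀ k ≥ N, ∫ t in Ioo 0 L, |gs n t - gs k t| ^ q < ε)
    (hlim : ∀ t ∈ Icc 0 L, Tendsto (fun n => fs n t) atTop (𝓝 (f t))) :
    ∃ g, MemLp g (ENNReal.ofReal q) (volume.restrict (Ioo 0 L)) ∧ IsWeakDeriv L f g ∧
      Tendsto (fun n => ∫ t in Ioo 0 L, |gs n t - g t| ^ q) atTop (𝓝 0) := by
  have hq0 : 0 < q := by linarith
  have hq1 : (1 : ℝ≥0∞) ≤ ENNReal.ofReal q := by simpa using ENNReal.ofReal_le_ofReal hq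
  have : Fact (1 ≤ ENNReal.ofReal q) := ⟨hq1⟩
  set μ := volume.restrict (Ioo 0 L) with hμ
  set G : ℕ → Lp ℝ (ENNReal.ofReal q) μ := fun n => (hgs n).toLp (gs n) with hG
  have hGc : CauchySeq G := by
    rw [Metric.cauchySeq_iff]
    intro ε hε
    obtain ⟨N, hN⟩ := hcau (ε ^ q) (by positivity)
    refine ⟨N, fun n hn k hk => ?_⟩
    have h1 := hN n hn k hk
    have h2 := norm_toLp_rpow hq ((hgs n).sub (hgs k))
    rw [dist_eq_norm, hG, ← MemLp.toLp_sub]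
    simp only [Pi.sub_apply] at h2
    rw [← h2] at h1
    exact (Real.rpow_lt_rpow_iff (norm_nonneg _) hε.le hq0).mp h1
  obtain ⟨g, hg⟩ := cauchySeq_tendsto_of_complete hGc
  have hgm := Lp.memLp g
  have hnorm : Tendsto (fun n => ‖G n - g‖) atTop (𝓝 0) := tendsto_iff_norm_sub_tendsto_zero.mp hg
  have hsub : ∀ n, G n - g = ((hgs n).sub hgm).toLp (gs n - ⇑g) := fun n => by
    rw [MemLp.toLp_sub (hgs n) hgm, Lp.toLp_coeFn]
  refine ⟨g, hgm, ?_, ?_⟩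
  · have hgi : IntegrableOn g (Ioo 0 L) := hgm.integrable hq1
    refine isWeakDeriv_of_forall_eq_add_integral hL hgi fun t ht => ?_
    have h0 : (0 : ℝ) ∈ Icc 0 L := ⟨le_rfl, hL.le⟩
    -- On a bounded interval `L^q` convergence implies `L^1` convergence, so the primitives of `gs
    -- n` converge and `f` is a primitive of `g`.
    have hL1 : Tendsto (fun n => eLpNorm (gs n - ⇑g) 1 μ) atTop (𝓝 0) := by
      have h1 : ∀ n, eLpNorm (gs n - ⇑g) (ENNReal.ofReal q) μ = ENNReal.ofReal ‖G n - g‖ := by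
        intro n
        rw [hsub, Lp.norm_toLp, ENNReal.ofReal_toReal ((hgs n).sub hgm).2.ne]
      have h2 : Tendsto (fun n => ENNReal.ofReal ‖G n - g‖ * μ univ ^ (1 / (1 : ℝ≥0∞).toReal -
          1 / (ENNReal.ofReal q).toReal)) atTop (𝓝 0) := by
        have h3 := ENNReal.tendsto_ofReal hnorm
        rw [ENNReal.ofReal_zero] at h3
        have h4 : μ univ ^ (1 / (1 : ℝ≥0∞).toReal - 1 / (ENNReal.ofReal q).toReal) ≠ ⊤ := by
          refine ENNReal.rpow_ne_top_of_nonneg ?_ (measure_ne_top _ _)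
          rw [ENNReal.toReal_ofReal hq0.le, ENNReal.toReal_one, div_one, sub_nonneg]
          exact div_le_one_of_le₀ hq hq0.le
        simpa using ENNReal.Tendsto.mul_const h3 (Or.inr h4)
      refine tendsto_of_tendsto_of_tendsto_of_le_of_le tendsto_const_nhds h2
        (fun n => zero_le) fun n => ?_
      simp only
      rw [← h1 n]
      exact eLpNorm_le_eLpNorm_mul_rpow_measure_univ hq1 ((hgs n).sub hgm).1
    have hint := tendsto_setIntegral_of_L1' g hgm.1
      (Eventually.of_forall fun n => (hw n).2.1) hL1 (Ioc 0 t)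
    have hset : ∀ h : ℝ → ℝ, ∫ x in Ioc 0 t, h x ∂μ = ∫ x in (0 : ℝ)..t, h x := fun h => by
      rw [hμ, restrict_Ioo_eq_restrict_Ioc, Measure.restrict_restrict measurableSet_Ioc,
        inter_eq_left.mpr (Ioc_subset_Ioc_right ht.2), intervalIntegral.integral_of_le ht.1]
    simp only [hset] at hint
    have h5 : ∀ n, ∫ x in (0 : ℝ)..t, gs n x = fs n t - fs n 0 := fun n =>
      (hw n).integral_eq_sub hL (hfs n) h0 ht
    simp only [h5] at hint
    have := tendsto_nhds_unique hint ((hlim t ht).sub (hlim 0 h0))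
    linarith
  · have h1 : ∀ n, ∫ t in Ioo 0 L, |gs n t - g t| ^ q = ‖G n - g‖ ^ q := fun n => by
      rw [hsub, norm_toLp_rpow hq]
      rfl
    refine Tendsto.congr (fun n => (h1 n).symm) ?_
    simpa [Real.zero_rpow hq0.ne'] using hnorm.rpow_const (Or.inr hq0.le)

end

/-! ### Weak convergence in `W^{1,q}` -/

noncomputable section

namespace MetricGraph

variable {V E : Type*} {G : MetricGraph V E}

theorem edgeDeriv_sub_ae {u v : G.Point → ℝ} {p : ℝ≥0∞} (hu : u ∈ G.sobolev p)
    (hv : v ∈ G.sobolev p) (e : E) :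
    G.edgeDeriv (u - v) e =ᵐ[volume.restrict (Ioo 0 (G.len e))]
      fun t => G.edgeDeriv u e t - G.edgeDeriv v e t := by
  have h : u - v = u + (-1 : ℝ) • v := by rw [neg_one_smul, sub_eq_add_neg]
  rw [h]
  filter_upwards [edgeDeriv_add_ae hu (Submodule.smul_mem _ (-1 : ℝ) hv) e,
    edgeDeriv_smul_ae hv (-1) e] with t h1 h2
  rw [h1, h2]
  ring

variable [Fintype E]

theorem intPow_edgeDeriv_clarkson {q : ℝ} (hq : 2 ≤ q) {u v : G.Point → ℝ}
    (hu : u ∈ G.sobolev (ENNReal.ofReal q)) (hv : v ∈ G.sobolev (ENNReal.ofReal q)) :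
    G.intPow q (G.edgeDeriv ((1 / 2 : ℝ) • (u + v))) +
      G.intPow q (G.edgeDeriv ((1 / 2 : ℝ) • (u - v))) ≤
      (G.intPow q (G.edgeDeriv u) + G.intPow q (G.edgeDeriv v)) / 2 := by
  have hq0 : 0 < q := by linarith
  have h1 : ∀ e, G.edgeDeriv ((1 / 2 : ℝ) • (u + v)) e =ᵐ[volume.restrict (Ioo 0 (G.len e))]
      fun t => 1 / 2 * (G.edgeDeriv u e t + G.edgeDeriv v e t) := fun e => by
    filter_upwards [edgeDeriv_smul_ae (Submodule.add_mem _ hu hv) (1 / 2) e,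
      edgeDeriv_add_ae hu hv e] with t h1 h2
    rw [h1, h2]
  have h2 : ∀ e, G.edgeDeriv ((1 / 2 : ℝ) • (u - v)) e =ᵐ[volume.restrict (Ioo 0 (G.len e))]
      fun t => 1 / 2 * (G.edgeDeriv u e t - G.edgeDeriv v e t) := fun e => by
    filter_upwards [edgeDeriv_smul_ae (Submodule.sub_mem _ hu hv) (1 / 2) e,
      edgeDeriv_sub_ae hu hv e] with t h1 h2
    rw [h1, h2]
  rw [intPow_congr h1, intPow_congr h2]
  simp only [intPow]
  rw [← Finset.sum_add_distrib, ← Finset.sum_add_distrib, Finset.sum_div]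
  refine Finset.sum_le_sum fun e _ => ?_
  have mu := memLp_edgeDeriv hu e
  have mv := memLp_edgeDeriv hv e
  have i1 := integrable_abs_rpow hq0 ((mu.add mv).const_mul (1 / 2))
  have i2 := integrable_abs_rpow hq0 ((mu.sub mv).const_mul (1 / 2))
  have i3 := integrable_abs_rpow hq0 mu
  have i4 := integrable_abs_rpow hq0 mv
  simp only [Pi.add_apply, Pi.sub_apply] at i1 i2
  rw [← integral_add i1 i2, ← integral_add i3 i4, ← integral_div]
  exact integral_mono (i1.add i2) ((i3.add i4).div_const 2) fun t => Real.clarkson hq _ _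

/-- Sequences of Sobolev functions that converge uniformly and whose derivatives are Cauchy in
`L^q` converge in `W^{1,q}`. -/
theorem mem_sobolev_and_tendsto_of_cauchy {q : ℝ} (hq : 1 ≤ q) {us : ℕ → G.Point → ℝ}
    {u : G.Point → ℝ} (hus : ∀ n, us n ∈ G.sobolev (ENNReal.ofReal q))
    (hcau : ∀ ε > 0, ∃ N, ∀ n ≥ N, ∀ k ≥ N,
      G.intPow q (G.edgeDeriv ((1 / 2 : ℝ) • (us n - us k))) < ε)
    (hlim : TendstoUniformly us u atTop) :
    u ∈ G.sobolev (ENNReal.ofReal q) ∧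
      Tendsto (fun n => G.intPow q (G.edgeDeriv (us n - u))) atTop (𝓝 0) := by
  have hq0 : 0 < q := by linarith
  have hu : Continuous u := hlim.continuous (Frequently.of_forall fun n => (hus n).1)
  have hsub : ∀ n k e, G.edgeDeriv ((1 / 2 : ℝ) • (us n - us k)) e
      =ᵐ[volume.restrict (Ioo 0 (G.len e))]
      fun t => 1 / 2 * (G.edgeDeriv (us n) e t - G.edgeDeriv (us k) e t) := fun n k e => by
    filter_upwards [edgeDeriv_smul_ae (Submodule.sub_mem _ (hus n) (hus k)) (1 / 2) e,
      edgeDeriv_sub_ae (hus n) (hus k) e] with t h1 h2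
    rw [h1, h2]
  have hedge : ∀ e, ∃ g, MemLp g (ENNReal.ofReal q) (volume.restrict (Ioo 0 (G.len e))) ∧
      IsWeakDeriv (G.len e) (G.edgeFun u e) g ∧
      Tendsto (fun n => ∫ t in Ioo 0 (G.len e), |G.edgeDeriv (us n) e t - g t| ^ q)
        atTop (𝓝 0) := by
    intro e
    refine exists_isWeakDeriv_of_cauchy (G.len_pos e) hq (fs := fun n => G.edgeFun (us n) e)
      (fun n => (continuous_edgeFun (hus n).1 e).continuousOn)
      (fun n => isWeakDeriv_edgeDeriv (hus n) e) (fun n => memLp_edgeDeriv (hus n) e) ?_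
      fun t _ => hlim.tendsto_at _
    intro ε hε
    obtain ⟨N, hN⟩ := hcau ((1 / 2) ^ q * ε) (by positivity)
    refine ⟨N, fun n hn k hk => ?_⟩
    have h1 := hN n hn k hk
    rw [intPow_congr (hsub n k), intPow_const_mul, abs_of_pos one_half_pos] at h1
    refine lt_of_le_of_lt ?_ (lt_of_mul_lt_mul_left h1 (by positivity))
    exact Finset.single_le_sum
      (f := fun e => ∫ t in Ioo 0 (G.len e), |G.edgeDeriv (us n) e t - G.edgeDeriv (us k) e t| ^ q)
      (fun e _ => integral_nonneg fun t => by positivity) (Finset.mem_univ e)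
  choose g hg1 hg2 hg3 using hedge
  have hmem : u ∈ G.sobolev (ENNReal.ofReal q) := mem_sobolev_of_isWeakDeriv hu hg1 hg2
  refine ⟨hmem, ?_⟩
  have h1 : ∀ n, G.intPow q (G.edgeDeriv (us n - u)) =
      ∑ e, ∫ t in Ioo 0 (G.len e), |G.edgeDeriv (us n) e t - g e t| ^ q := fun n => by
    refine intPow_congr (g := fun e t => G.edgeDeriv (us n) e t - g e t) fun e => ?_
    filter_upwards [edgeDeriv_sub_ae (hus n) hmem e, (hg2 e).weakDeriv_ae_eq] with t h1 h2
    rw [h1, edgeDeriv, edgeDeriv, h2]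
  simp only [h1]
  simpa using tendsto_finsetSum Finset.univ fun e _ => hg3 e

theorem tendsto_intPow_of_le {r q : ℝ} (hr : 0 < r) (hrq : r ≤ q) {f : ℕ → E → ℝ → ℝ}
    (hf : ∀ n e, MemLp (f n e) (ENNReal.ofReal q) (volume.restrict (Ioo 0 (G.len e))))
    (h : Tendsto (fun n => G.intPow q (f n)) atTop (𝓝 0)) :
    Tendsto (fun n => G.intPow r (f n)) atTop (𝓝 0) := by
  have hT : 0 ≤ ∑ e, G.len e := Finset.sum_nonneg fun e _ => (G.len_pos e).le
  rw [tendsto_order]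
  refine ⟨fun a ha => Eventually.of_forall fun n => ha.trans_le (intPow_nonneg _ _),
    fun b hb => ?_⟩
  -- With this `K`, once `∫|f n|^q / K ^ q < 1` the bound of `intPow_le_mul_add` is at most `b / 2`.
  set K : ℝ := (b / (2 * (∑ e, G.len e + 1))) ^ (1 / r)
  have hK : 0 < K := by positivity
  have hKr : K ^ r = b / (2 * (∑ e, G.len e + 1)) := by
    rw [← Real.rpow_mul (by positivity), one_div_mul_cancel hr.ne', Real.rpow_one]
  have h2 := (h.div_const (K ^ q)).eventually_lt_const
    (show 0 / K ^ q < 1 by rw [zero_div]; exact one_pos)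
  filter_upwards [h2] with n hn
  refine (intPow_le_mul_add hK hr hrq (hf n)).trans_lt ?_
  rw [hKr, div_mul_eq_mul_div, div_lt_iff₀ (by positivity)]
  nlinarith

theorem tendsto_sobolevNorm {q : ℝ} (hq : 0 < q) {us : ℕ → G.Point → ℝ}
    (h : TendstoUniformly us 0 atTop)
    (hd : Tendsto (fun n => G.intPow q (G.edgeDeriv (us n))) atTop (𝓝 0)) :
    Tendsto (fun n => G.sobolevNorm q (us n)) atTop (𝓝 0) := by
  have hT : 0 ≤ ∑ e, G.len e := Finset.sum_nonneg fun e _ => (G.len_pos e).le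
  have h1 : Tendsto (fun n => G.intPow q (G.edgeFun (us n))) atTop (𝓝 0) := by
    rw [tendsto_order]
    refine ⟨fun a ha => Eventually.of_forall fun n => ha.trans_le (intPow_nonneg _ _),
      fun b hb => ?_⟩
    set K : ℝ := (b / (∑ e, G.len e + 1)) ^ (1 / q)
    have hK : 0 < K := by positivity
    have hKq : K ^ q = b / (∑ e, G.len e + 1) := by
      rw [← Real.rpow_mul (by positivity), one_div_mul_cancel hq.ne', Real.rpow_one]
    filter_upwards [Metric.tendstoUniformly_iff.mp h K hK] with n hn
    refine (intPow_le_of_abs_le hq (K := K) fun e => ae_of_all _ fun t => ?_).trans_lt ?_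
    · have := hn (G.onEdge e (projIcc 0 (G.len e) (G.len_pos e).le t))
      rw [Pi.zero_apply, dist_zero_left] at this
      exact this.le
    · rw [hKq, div_mul_eq_mul_div, div_lt_iff₀ (by positivity)]
      nlinarith
  have h2 := (h1.add hd).rpow_const (p := 1 / q) (Or.inr (one_div_pos.mpr hq).le)
  rwa [add_zero, Real.zero_rpow (one_div_pos.mpr hq).ne'] at h2

/-- Bounded sequences in `W^{1,q}` have convex combinations of their tails whose derivatives are
Cauchy in `L^q`. -/
theorem exists_convexHull_cauchy_intPow {q : ℝ} (hq : 2 ≤ q)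
    {w : ℕ → G.sobolev (ENNReal.ofReal q)} {C : ℝ}
    (hC : ∀ j, G.intPow q (G.edgeDeriv (w j).1) ≤ C) :
    ∃ y : ℕ → G.sobolev (ENNReal.ofReal q), (∀ n, y n ∈ convexHull ℝ (w '' Ici n)) ∧
      ∀ ε > 0, ∃ N, ∀ n ≥ N, ∀ k ≥ N,
        G.intPow q (G.edgeDeriv ((1 / 2 : ℝ) • ((y n).1 - (y k).1))) < ε := by
  have h : ∀ a b : G.sobolev (ENNReal.ofReal q),
      G.intPow q (G.edgeDeriv ((1 / 2 : ℝ) • (a + b) : G.sobolev (ENNReal.ofReal q)).1) +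
      G.intPow q (G.edgeDeriv ((1 / 2 : ℝ) • (a - b) : G.sobolev (ENNReal.ofReal q)).1) ≤
      (G.intPow q (G.edgeDeriv a.1) + G.intPow q (G.edgeDeriv b.1)) / 2 := by
    intro a b
    rw [Submodule.coe_smul, Submodule.coe_smul, Submodule.coe_add, Submodule.coe_sub]
    exact intPow_edgeDeriv_clarkson hq a.2 b.2
  obtain ⟨y, hy, hcau⟩ := exists_convexHull_cauchy
    (Q := fun a : G.sobolev (ENNReal.ofReal q) => G.intPow q (G.edgeDeriv a.1))
    (fun a => intPow_nonneg _ _) h hC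
  refine ⟨y, hy, fun ε hε => ?_⟩
  obtain ⟨N, hN⟩ := hcau ε hε
  refine ⟨N, fun n hn k hk => ?_⟩
  have := hN n hn k hk
  rwa [Submodule.coe_smul, Submodule.coe_sub] at this

/-- Convex combinations of the tails of a uniformly convergent sequence converge uniformly. -/
theorem tendstoUniformly_of_mem_convexHull {X : Type*} {S : Submodule ℝ (X → ℝ)} {w y : ℕ → S}
    {u : X → ℝ} (hlim : TendstoUniformly (fun j => (w j : X → ℝ)) u atTop)
    (hy : ∀ n, y n ∈ convexHull ℝ (w '' Ici n)) :
    TendstoUniformly (fun n => (y n : X → ℝ)) u atTop := by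
  rw [Metric.tendstoUniformly_iff] at hlim ⊢
  intro η hη
  obtain ⟨N, hN⟩ := eventually_atTop.mp (hlim (η / 2) (by positivity))
  filter_upwards [eventually_ge_atTop N] with n hn x
  -- At a fixed point, being within `η / 2` of `u` is a convex condition, so it passes from the tail
  -- to its convex hull.
  have hconv : Convex ℝ {z : S | |u x - z.1 x| ≤ η / 2} := by
    intro a ha b hb s t hs ht hst
    have e : u x - (s • a + t • b).1 x = s * (u x - a.1 x) + t * (u x - b.1 x) := by
      change u x - (s * a.1 x + t * b.1 x) = _
      linear_combination (-u x) * hst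
    rw [mem_ofPred_eq, e]
    calc |s * (u x - a.1 x) + t * (u x - b.1 x)|
        ≤ s * |u x - a.1 x| + t * |u x - b.1 x| := by
          refine (abs_add_le _ _).trans_eq ?_
          rw [abs_mul, abs_mul, abs_of_nonneg hs, abs_of_nonneg ht]
      _ ≤ s * (η / 2) + t * (η / 2) := by gcongr <;> assumption
      _ = η / 2 := by rw [← add_mul, hst, one_mul]
  have h1 : y n ∈ {z : S | |u x - z.1 x| ≤ η / 2} := by
    refine convexHull_min ?_ hconv (hy n)
    rintro _ ⟨j, hj, rfl⟩
    exact (hN j (hn.trans hj) x).le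
  exact lt_of_le_of_lt h1 (half_lt_self hη)

/-- A bounded linear functional cannot stay away from its value at the uniform limit of a sequence
that is bounded in `W^{1,r}`. -/
theorem exists_lt_of_tendstoUniformly {q r : ℝ} (hq : 1 ≤ q) (hqr : q ≤ r) (hr : 2 ≤ r)
    {w : ℕ → G.Point → ℝ} {u : G.Point → ℝ} {C : ℝ}
    (hw : ∀ j, w j ∈ G.sobolev (ENNReal.ofReal r))
    (hC : ∀ j, G.intPow r (G.edgeDeriv (w j)) ≤ C) (hlim : TendstoUniformly w u atTop)
    (hwq : ∀ j, w j ∈ G.sobolev (ENNReal.ofReal q)) (hu : u ∈ G.sobolev (ENNReal.ofReal q))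
    {φ : G.sobolev (ENNReal.ofReal q) →ₗ[ℝ] ℝ}
    (hφ : ∃ D : ℝ, ∀ w, |φ w| ≤ D * G.sobolevNorm q w) {ε : ℝ} (hε : 0 < ε) :
    ∃ j, φ ⟨w j, hwq j⟩ < φ ⟨u, hu⟩ + ε := by
  by_contra! hcon
  obtain ⟨D, hD⟩ := hφ
  have hle : G.sobolev (ENNReal.ofReal r) ≤ G.sobolev (ENNReal.ofReal q) :=
    sobolev_mono (ENNReal.ofReal_le_ofReal hqr)
  obtain ⟨y, hy, hcau⟩ := exists_convexHull_cauchy_intPow hr (w := fun j => ⟨w j, hw j⟩) hC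
  have hylim := tendstoUniformly_of_mem_convexHull (w := fun j => ⟨w j, hw j⟩) hlim hy
  obtain ⟨hur, hder⟩ := mem_sobolev_and_tendsto_of_cauchy (hq.trans hqr) (fun n => (y n).2)
    hcau hylim
  have hder' := tendsto_intPow_of_le (by linarith) hqr
    (fun n => memLp_edgeDeriv (Submodule.sub_mem _ (y n).2 hur)) hder
  have hunif : TendstoUniformly (fun n => (y n).1 - u) 0 atTop := by
    rw [Metric.tendstoUniformly_iff] at hylim ⊢
    intro η hη
    filter_upwards [hylim η hη] with n hn x
    have := hn x
    rwa [Pi.zero_apply, dist_zero_left, Pi.sub_apply, ← dist_eq_norm, dist_comm]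
  have hnorm := (tendsto_sobolevNorm (by linarith) hunif hder').const_mul D
  rw [mul_zero] at hnorm
  obtain ⟨n, hn⟩ := (hnorm.eventually_lt_const hε).exists
  -- The assumed gap places every `w j`, hence every convex combination `y n`, in a closed
  -- half-space missing `u`. But `y n` tends to `u` in the norm of `W^{1,q}`.
  have hincl : ∀ z, Submodule.inclusion hle z = ⟨z.1, hle z.2⟩ := fun _ => rfl
  have h1 : y n ∈ {z | φ ⟨u, hu⟩ + ε ≤ (φ ∘ₗ Submodule.inclusion hle) z} := by
    refine convexHull_min ?_ (convex_halfSpace_ge (LinearMap.isLinear _) _) (hy n)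
    rintro _ ⟨j, hj, rfl⟩
    rw [mem_ofPred_eq, LinearMap.comp_apply, hincl]
    exact hcon j
  rw [mem_ofPred_eq, LinearMap.comp_apply, hincl] at h1
  have h2 := hD (⟨(y n).1, hle (y n).2⟩ - ⟨u, hu⟩)
  rw [map_sub, Submodule.coe_sub] at h2
  have h3 := le_abs_self (φ ⟨(y n).1, hle (y n).2⟩ - φ ⟨u, hu⟩)
  linarith

/-- Uniform convergence implies weak convergence in `W^{1,q}` when `‖u_j'‖_{p_j}` is bounded and
`p_j → ∞`. -/
theorem tendstoWeakly_of_tendstoUniformly {p : ℕ → ℝ} {us : ℕ → G.Point → ℝ} {u : G.Point → ℝ}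
    {K : ℝ} (hp : Tendsto p atTop atTop) (hK : 0 < K)
    (hus : ∀ᶠ j in atTop, us j ∈ G.sobolev (ENNReal.ofReal (p j)))
    (hb : ∀ᶠ j in atTop, G.intPow (p j) (G.edgeDeriv (us j)) ≤ K ^ p j)
    (hlim : TendstoUniformly us u atTop) {q : ℝ} (hq : 1 ≤ q)
    (hu : u ∈ G.sobolev (ENNReal.ofReal q)) : G.TendstoWeakly q us u := by
  -- Clarkson's inequality requires an exponent at least `2`. Since `p j → ∞`, the sequence is
  -- eventually bounded in the smaller space `W^{1,r}`, which also covers `q = 1`.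
  set r := max q 2 with hr
  have hqr : q ≤ r := le_max_left _ _
  have hr2 : 2 ≤ r := le_max_right _ _
  obtain ⟨N, hN⟩ := eventually_atTop.mp (hus.and (hb.and (hp.eventually_ge_atTop r)))
  have hw : ∀ j, us (j + N) ∈ G.sobolev (ENNReal.ofReal r) := fun j =>
    sobolev_mono (ENNReal.ofReal_le_ofReal (hN _ (by omega)).2.2) (hN _ (by omega)).1
  have hwq : ∀ j, us (j + N) ∈ G.sobolev (ENNReal.ofReal q) := fun j =>
    sobolev_mono (ENNReal.ofReal_le_ofReal hqr) (hw j)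
  have hC : ∀ j, G.intPow r (G.edgeDeriv (us (j + N))) ≤ K ^ r * (∑ e, G.len e + 1) := by
    intro j
    obtain ⟨h1, h2, h3⟩ := hN (j + N) (by omega)
    refine (intPow_le_mul_add hK (by linarith) h3 (memLp_edgeDeriv h1)).trans ?_
    have : G.intPow (p (j + N)) (G.edgeDeriv (us (j + N))) / K ^ p (j + N) ≤ 1 :=
      div_le_one_of_le₀ h2 (by positivity)
    gcongr
  have hlimN : TendstoUniformly (fun j => us (j + N)) u atTop := fun s hs =>
    (tendsto_add_atTop_nat N).eventually (hlim s hs)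
  -- A one-sided bound suffices, as it will be applied to both `φ` and `-φ`. Its failure yields a
  -- subsequence on which `ψ` keeps the gap `ε`.
  have key : ∀ ψ : G.sobolev (ENNReal.ofReal q) →ₗ[ℝ] ℝ,
      (∃ D : ℝ, ∀ w, |ψ w| ≤ D * G.sobolevNorm q w) → ∀ ε > 0,
      ∀ᶠ j in atTop, ψ ⟨us (j + N), hwq j⟩ < ψ ⟨u, hu⟩ + ε := by
    intro ψ hψ ε hε
    by_contra hcon
    obtain ⟨s, hs, hs'⟩ := extraction_of_frequently_atTop (not_eventually.mp hcon)
    obtain ⟨j, hj⟩ := exists_lt_of_tendstoUniformly hq hqr hr2 (fun j => hw (s j))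
      (fun j => hC (s j)) (fun t ht => hs.tendsto_atTop.eventually (hlimN t ht))
      (fun j => hwq (s j)) hu hψ hε
    exact hs' j hj
  refine ⟨N, hwq, hu, fun φ hφ => ?_⟩
  rw [Metric.tendsto_nhds]
  intro ε hε
  have hφ' : ∃ D : ℝ, ∀ w, |(-φ) w| ≤ D * G.sobolevNorm q w := by
    obtain ⟨D, hD⟩ := hφ
    exact ⟨D, fun w => by simpa using hD w⟩
  filter_upwards [key φ hφ ε hε, key (-φ) hφ' ε hε] with j h1 h2
  rw [LinearMap.neg_apply, LinearMap.neg_apply] at h2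
  rw [Real.dist_eq, abs_lt]
  constructor <;> linarith

end MetricGraph

end

/-! ### Limits of normalized minimizers and the main theorem -/

noncomputable section

namespace MetricGraph

variable {V E : Type*} {G : MetricGraph V E} {VD : Set V} [Fintype E]

theorem intPow_eq_one_of_lpNorm_eq_one {p : ℝ} (hp : 0 < p) {u : G.Point → ℝ}
    (h : G.lpNorm p u = 1) : G.intPow p (G.edgeFun u) = 1 := by
  have h0 := intPow_nonneg (G := G) p (G.edgeFun u)
  rw [lpNorm] at h
  have h1 := Real.rpow_mul h0 (1 / p) p
  rwa [h, Real.one_rpow, one_div_mul_cancel hp.ne', Real.rpow_one] at h1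

theorem IsMinimizer.intPow_edgeDeriv_eq {p : ℝ} {u : G.Point → ℝ} (hu : G.IsMinimizer p VD u)
    (h1 : G.intPow p (G.edgeFun u) = 1) :
    G.intPow p (G.edgeDeriv u) = G.firstEigenvalue p VD := by
  rw [← hu.2, rayleigh, h1, div_one]

variable [Finite V] [Nonempty E]

/-- Properties of uniform limits of normalized minimizers. -/
theorem Connected.limit_of_minimizers (hG : G.Connected) {M : ℝ} (hM0 : 0 < M)
    (hM : IsGreatest (range (G.distTo VD)) M) (hVD : VD.Nonempty) {p : ℕ → ℝ}
    {us : ℕ → G.Point → ℝ} {u : G.Point → ℝ} (hp1 : ∀ j, 1 < p j) (hp : Tendsto p atTop atTop)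
    (hus : ∀ j, G.IsMinimizer (p j) VD (us j)) (hn : ∀ j, G.lpNorm (p j) (us j) = 1)
    (hlim : TendstoUniformly us u atTop) :
    (∀ e s t, |u (G.onEdge e t) - u (G.onEdge e s)| ≤ 1 / M * |(t : ℝ) - s|) ∧
      (∀ v ∈ VD, u (G.vertex v) = 0) ∧ ∃ x, 1 ≤ |u x| := by
  have h1 : ∀ j, G.intPow (p j) (G.edgeFun (us j)) = 1 := fun j =>
    intPow_eq_one_of_lpNorm_eq_one (by linarith [hp1 j]) (hn j)
  refine ⟨abs_sub_le_of_tendsto hp (one_div_pos.mpr hM0).le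
    (Eventually.of_forall fun j => (hus j).1.1) (fun k hk => ?_) fun x => hlim.tendsto_at x,
    fun v hv => tendsto_nhds_unique (hlim.tendsto_at _)
      (tendsto_const_nhds.congr fun j => ((hus j).1.2.1 v hv).symm),
    exists_one_le_abs_of_tendstoUniformly hp
      (hlim.continuous (Frequently.of_forall fun j => (hus j).1.1.1))
      (Eventually.of_forall h1) hlim⟩
  filter_upwards [hp.eventually (hG.eventually_firstEigenvalue_le hVD hM0 hM hk)] with j hj
  rwa [(hus j).intPow_edgeDeriv_eq (h1 j)]

/-- Normalized minimizers have a subsequence that converges uniformly and weakly in every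
`W^{1,q}`. -/
theorem Connected.exists_limit_of_minimizers (hG : G.Connected) {M : ℝ} (hM0 : 0 < M)
    (hM : IsGreatest (range (G.distTo VD)) M) (hVD : VD.Nonempty) {us : ℝ → G.Point → ℝ}
    (hus : ∀ p, 1 < p → G.IsMinimizer p VD (us p) ∧ G.lpNorm p (us p) = 1) :
    ∃ (p : ℕ → ℝ) (u : G.Point → ℝ), (∀ j, 1 < p j) ∧ Tendsto p atTop atTop ∧
      TendstoUniformly (fun j => us (p j)) u atTop ∧
      ∀ q, 1 ≤ q → G.TendstoWeakly q (fun j => us (p j)) u := by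
  -- Any constant above `1 / M` would do: it bounds `‖u_p'‖_p` for all large `p`.
  have hk : 1 / M < 1 / M + 1 := lt_add_one _
  have hK : 0 < 1 / M + 1 := by positivity
  obtain ⟨P, hP⟩ := eventually_atTop.mp
    ((hG.eventually_firstEigenvalue_le hVD hM0 hM hk).and (eventually_ge_atTop 2))
  set p : ℕ → ℝ := fun j => P + j
  have hpP : ∀ j, P ≤ p j := fun j => le_add_of_nonneg_right (Nat.cast_nonneg j)
  have hp2 : ∀ j, 2 ≤ p j := fun j => (hP _ (hpP j)).2
  have hp1 : ∀ j, 1 < p j := fun j => one_lt_two.trans_le (hp2 j)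
  have hp : Tendsto p atTop atTop := tendsto_atTop_add_const_left _ _ tendsto_natCast_atTop_atTop
  have hb : ∀ j, G.intPow (p j) (G.edgeDeriv (us (p j))) ≤ (1 / M + 1) ^ p j := fun j => by
    rw [(hus _ (hp1 j)).1.intPow_edgeDeriv_eq
      (intPow_eq_one_of_lpNorm_eq_one (by linarith [hp1 j]) (hus _ (hp1 j)).2)]
    exact (hP _ (hpP j)).1
  obtain ⟨φ, u, hφ, _, hlim⟩ := hG.exists_subseq_tendstoUniformly hVD hp2 hK
    (fun j => (hus _ (hp1 j)).1.1.1) (fun j => (hus _ (hp1 j)).1.1.2.1) hb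
  have hpφ := hp.comp hφ.tendsto_atTop
  -- The Lipschitz bound puts the limit in every `W^{1,q}`, as weak convergence there requires.
  obtain ⟨hlip, -, -⟩ := hG.limit_of_minimizers hM0 hM hVD (fun j => hp1 (φ j)) hpφ
    (fun j => (hus _ (hp1 (φ j))).1) (fun j => (hus _ (hp1 (φ j))).2) hlim
  exact ⟨fun j => p (φ j), u, fun j => hp1 (φ j), hpφ, hlim, fun q hq =>
    tendstoWeakly_of_tendstoUniformly hpφ hK
      (Eventually.of_forall fun j => (hus _ (hp1 (φ j))).1.1.1)
      (Eventually.of_forall fun j => hb (φ j)) hlim hq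
      (mem_sobolev_of_lipschitz (one_div_pos.mpr hM0).le hlip _)⟩

end MetricGraph

end

theorem mainTheorem5 {V E : Type*} [Finite V] [Fintype E] [Nonempty E] (G : MetricGraph V E)
    (hG : G.Connected) (VD : Set V) (hVD : VD.Nonempty) :
    (∀ u : ℝ → G.Point → ℝ,
      (∀ p, 1 < p → G.IsMinimizer p VD (u p) ∧ G.lpNorm p (u p) = 1) →
        (∃ (p : ℕ → ℝ) (uinf : G.Point → ℝ), (∀ j, 1 < p j) ∧ Tendsto p atTop atTop ∧
          TendstoUniformly (fun j => u (p j)) uinf atTop ∧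
          ∀ q, 1 ≤ q → G.TendstoWeakly q (fun j => u (p j)) uinf) ∧
        (∀ (p : ℕ → ℝ) (uinf : G.Point → ℝ), (∀ j, 1 < p j) → Tendsto p atTop atTop →
          TendstoUniformly (fun j => u (p j)) uinf atTop → G.IsMinimizerInf VD uinf)) ∧
    Tendsto (fun p : ℝ => G.firstEigenvalue p VD ^ (1 / p)) atTop (𝓝 (G.eigenInf VD)) ∧
    ∃ M : ℝ, 0 < M ∧ IsGreatest (range (G.distTo VD)) M ∧ G.eigenInf VD = 1 / M := by
  obtain ⟨M, hM0, hM⟩ := hG.exists_isGreatest_distTo hVD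
  have he := hG.eigenInf_eq hVD hM0 hM
  refine ⟨fun u hu => ⟨hG.exists_limit_of_minimizers hM0 hM hVD hu,
    fun p uinf hp1 hp hlim => ?_⟩, ?_, M, hM0, hM, he⟩
  · obtain ⟨hlip, h0, x, hx⟩ := hG.limit_of_minimizers hM0 hM hVD hp1 hp
      (fun j => (hu _ (hp1 j)).1) (fun j => (hu _ (hp1 j)).2) hlim
    exact hG.isMinimizerInf_of_lipschitz hVD (by rwa [he]) hM0 hM h0 hx
  · rw [he]
    exact hG.tendsto_firstEigenvalue_rpow hVD hM0 hM
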